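/- A median set is a set $X$ with a ternary operation $m$ satisfying $m(x,y,z)=m(y,x,z)=m(x,z,y)$, $m(x,y,x)=x$ and $m(m(x,y,z),u,v)=m(m(x,u,v),m(y,u,v),z)$. Let $\mathbf{FAMS}$ be the category of free actions $(G,X)$ of groups by automorphisms on nonempty median sets; a morphism $(G,X)\to(G',X')$ is a pair $(\psi_0,\psi)$ of a group morphism $\psi_0:G\to G'$ and a morphism of median sets $\psi:X\to X'$ with $\psi(gx)=\psi_0(g)\psi(x)$; it is an embedding if $\psi_0$ and $\psi$ are injective, and relatively transitive if $\psi(X)$ lies in a single $G'$-orbit. Let $\mathbf{FTAMS}$ be the full subcategory of the free and transitive actions, with inclusion $\iota$. Let $\mathbf{FAPMS}$ be the category of free actions on median sets with a base point, with the base point preserving morphisms, and let $\mathbf{MG}$ be the category of median groups, i.e. groups with a median operation $m$ such that $a\,m(x,y,z)=m(ax,ay,az)$, with the group morphisms preserving $m$; $\mathbf{MG}$ is mapped to $\mathbf{FAPMS}$ by letting a median group act on itself by left translations, with base point $1$. A relatively-transitive closure of $A\in\mathbf{FAMS}$ is a relatively transitive embedding $A\to B$ in $\mathbf{FAMS}$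 such that every relatively transitive morphism $A\to C$ in $\mathbf{FAMS}$ factors uniquely through it. **Theorem 5.1 (with Theorems 3 and 3').** There exist an endofunctor $\mathrm{RTC}$ of $\mathbf{FAMS}$ and a natural transformation $\mathrm{rtc}:1_{\mathbf{FAMS}}\to\mathrm{RTC}$ such that $\mathrm{rtc}_A:A\to\mathrm{RTC}(A)$ is a relatively-transitive closure for every $A$. For any such pair, put $\mathrm{RTC}_0=1_{\mathbf{FAMS}}$, $\mathrm{RTC}_{n+1}=\mathrm{RTC}\circ\mathrm{RTC}_n$, with connecting morphisms $\mathrm{rtc}_{\mathrm{RTC}_n(A)}:\mathrm{RTC}_n(A)\to\mathrm{RTC}_{n+1}(A)$. (A) $\mathbf{FTAMS}$ is a reflective full subcategory of $\mathbf{FAMS}$: the inclusion $\iota$ has a left adjoint $\mathrm{TC}$. For every left adjoint $\mathrm{TC}$ of $\iota$: 1. $\iota\circ\mathrm{TC}$ is the direct limit of the direct system $(\mathrm{RTC}_n)_{n\in\mathbb N}$ of endofunctors of $\mathbf{FAMS}$ (also objectwise), the canonical map $1_{\mathbf{FAMS}}=\mathrm{RTC}_0\to\iota\circ\mathrm{TC}$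 being the unit of the adjunction; 2. the counit $\mathrm{TC}\circ\iota\to 1_{\mathbf{FTAMS}}$ is a natural isomorphism; 3. the unit $1_{\mathbf{FAMS}}\to\iota\circ\mathrm{TC}$ is a natural monomorphism, and all its components are embeddings; so every free action on a nonempty median set embeds into a free and transitive one. (B) The functor $\mathbf{MG}\to\mathbf{FAPMS}$ is fully faithful and has a left adjoint, so $\mathbf{MG}$ is identified with a reflective full subcategory of $\mathbf{FAPMS}$. An object of $\mathbf{FAPMS}$ is isomorphic to the image of a median group if and only if its action is transitive, and an object of $\mathbf{FAMS}$ is isomorphic to the action of a median group on itself by left translations if and only if it is transitive. For every left adjoint of $\mathbf{MG}\to\mathbf{FAPMS}$ the counit is an isomorphism and the components of the unit are monomorphisms and embeddings, so every free action on a pointed median set embeds into the median group freely generated by it. After forgetting base points, this embedding is isomorphic, under the original action, to the unit $A\to\iota\,\mathrm{TC}(A)$ of (A). -/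

import Mathlib

open CategoryTheory CategoryTheory.Limits

universe u

/-- A median set (median algebra): a set with a ternary operation `m` that is symmetric,
absorptive and selfdistributive. -/
class MedianSet (X : Type u) where
  m : X → X → X → X
  symm_left : ∀ x y z, m x y z = m y x z
  symm_right : ∀ x y z, m x y z = m x z y
  absorb : ∀ x y, m x y x = x
  selfdistrib : ∀ x y z v w, m (m x y z) v w = m (m x v w) (m y v w) z

/-- The objects of FAMS: a group `G` acting freely, by automorphisms of median sets, on a
nonempty median set `X`. -/
structure FAMS : Type (u + 1) where
  G : Type u
  X : Type u
  [group : Group G]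
  [median : MedianSet X]
  [action : MulAction G X]
  nonempty : Nonempty X
  smul_m : ∀ (g : G) (x y z : X),
    g • MedianSet.m x y z = MedianSet.m (g • x) (g • y) (g • z)
  free : ∀ (g : G) (x : X), g • x = x → g = 1

attribute [instance] FAMS.group FAMS.median FAMS.action

namespace FAMS

/-- A morphism of actions on median sets: a group morphism together with an equivariant morphism
of median sets. -/
@[ext]
structure Hom (A B : FAMS.{u}) : Type u where
  onG : A.G →* B.G
  onX : A.X → B.X
  map_m : ∀ x y z : A.X,
    onX (MedianSet.m x y z) = MedianSet.m (onX x) (onX y) (onX z)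
  map_smul : ∀ (g : A.G) (x : A.X), onX (g • x) = onG g • onX x

instance category : Category.{u} FAMS.{u} where
  Hom := Hom
  id A :=
    { onG := MonoidHom.id A.G
      onX := fun x => x
      map_m := fun _ _ _ => rfl
      map_smul := fun _ _ => rfl }
  comp f g :=
    { onG := g.onG.comp f.onG
      onX := fun x => g.onX (f.onX x)
      map_m := fun x y z => by rw [f.map_m, g.map_m]
      map_smul := fun h x => by rw [f.map_smul, g.map_smul]; rfl }

/-- A morphism is an embedding if both its components are injective. -/
def IsEmbedding {A B : FAMS.{u}} (f : A ⟶ B) : Prop :=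
  Function.Injective (Hom.onG f) ∧ Function.Injective (Hom.onX f)

/-- The image of the median set of `A` lies in a single orbit of the group of `B`. -/
def IsRelativelyTransitive {A B : FAMS.{u}} (f : A ⟶ B) : Prop :=
  ∀ x y : A.X, ∃ g : B.G, Hom.onX f y = g • Hom.onX f x

/-- `i : A ⟶ B` exhibits `B` as the relatively-transitive closure of `A`: it is a
relatively transitive embedding through which every relatively transitive morphism out of `A`
factors uniquely. -/
structure IsRelTransClosure {A B : FAMS.{u}} (i : A ⟶ B) : Prop where
  embedding : IsEmbedding i
  relativelyTransitive : IsRelativelyTransitive i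
  universal : ∀ (C : FAMS.{u}) (f : A ⟶ C), IsRelativelyTransitive f →
    ∃! g : B ⟶ C, i ≫ g = f

/-- An endofunctor `R` of FAMS with a natural transformation `r` from the identity is a
relatively-transitive closure functor if `r` exhibits each `R A` as the relatively-transitive
closure of `A`. -/
def IsRelTransClosureFunctor {R : FAMS.{u} ⥤ FAMS.{u}} (r : 𝟭 FAMS.{u} ⟶ R) : Prop :=
  ∀ A : FAMS.{u}, IsRelTransClosure (r.app A)

/-- The iterates of an endofunctor. -/
def iter (R : FAMS.{u} ⥤ FAMS.{u}) : ℕ → (FAMS.{u} ⥤ FAMS.{u})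
  | 0 => 𝟭 FAMS.{u}
  | n + 1 => iter R n ⋙ R

/-- The connecting natural transformation from an iterate to the next one, with component
`r (R^n A) : R^n A ⟶ R (R^n A)` at `A`. -/
def iterStep {R : FAMS.{u} ⥤ FAMS.{u}} (r : 𝟭 FAMS.{u} ⟶ R) (n : ℕ) :
    iter R n ⟶ iter R (n + 1) where
  app A := r.app ((iter R n).obj A)
  naturality _ _ f := r.naturality ((iter R n).map f)

/-- The direct system `R^0 ⟶ R^1 ⟶ R^2 ⟶ ⋯` of endofunctors of FAMS. -/
def iterSystem {R : FAMS.{u} ⥤ FAMS.{u}} (r : 𝟭 FAMS.{u} ⟶ R) :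
    ℕ ⥤ (FAMS.{u} ⥤ FAMS.{u}) :=
  Functor.ofSequence (iterStep r)

/-- The action is transitive. -/
def IsTransitive : ObjectProperty FAMS.{u} :=
  fun A => ∀ x y : A.X, ∃ g : A.G, y = g • x

end FAMS

/-- The full subcategory of FAMS of the free and transitive actions. -/
abbrev FTAMS : Type (u + 1) := FAMS.IsTransitive.{u}.FullSubcategory

/-- The embedding of FTAMS into FAMS. -/
abbrev FTAMS.incl : FTAMS.{u} ⥤ FAMS.{u} := FAMS.IsTransitive.{u}.ι

/-- The objects of FAPMS: free actions on pointed median sets. -/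
structure FAPMS : Type (u + 1) where
  toFAMS : FAMS.{u}
  pt : toFAMS.X

namespace FAPMS

/-- The morphisms of FAPMS: the morphisms of FAMS that preserve the base points. -/
@[ext]
structure Hom (A B : FAPMS.{u}) : Type u where
  toHom : A.toFAMS ⟶ B.toFAMS
  map_pt : FAMS.Hom.onX toHom A.pt = B.pt

instance category : Category.{u} FAPMS.{u} where
  Hom := Hom
  id A := { toHom := 𝟙 A.toFAMS, map_pt := rfl }
  comp f g :=
    { toHom := f.toHom ≫ g.toHom
      map_pt := (congrArg (FAMS.Hom.onX g.toHom) f.map_pt).trans g.map_pt }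

/-- The functor forgetting the base point. -/
def forget : FAPMS.{u} ⥤ FAMS.{u} where
  obj A := A.toFAMS
  map f := Hom.toHom f

end FAPMS

/-- A median group: a group with a median operation that is invariant under the left
translations. -/
structure MedianGroup : Type (u + 1) where
  carrier : Type u
  [group : Group carrier]
  [median : MedianSet carrier]
  mul_m : ∀ a x y z : carrier,
    a * MedianSet.m x y z = MedianSet.m (a * x) (a * y) (a * z)

attribute [instance] MedianGroup.group MedianGroup.median

namespace MedianGroup

/-- A morphism of median groups: a group morphism that preserves the medians. -/
@[ext]
structure Hom (A B : MedianGroup.{u}) : Type u where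
  toMonoidHom : A.carrier →* B.carrier
  map_m : ∀ x y z : A.carrier, toMonoidHom (MedianSet.m x y z) =
    MedianSet.m (toMonoidHom x) (toMonoidHom y) (toMonoidHom z)

instance category : Category.{u} MedianGroup.{u} where
  Hom := Hom
  id A := { toMonoidHom := MonoidHom.id A.carrier, map_m := fun _ _ _ => rfl }
  comp f g :=
    { toMonoidHom := g.toMonoidHom.comp f.toMonoidHom
      map_m := fun x y z => by
        simp only [MonoidHom.comp_apply, f.map_m, g.map_m] }

/-- The embedding of the category of median groups into FAPMS: a median group acts on its
underlying median set by left translations, and the base point is the neutral element. -/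
def toFAPMS : MedianGroup.{u} ⥤ FAPMS.{u} where
  obj A :=
    { toFAMS :=
        { G := A.carrier
          X := A.carrier
          nonempty := ⟨1⟩
          smul_m := A.mul_m
          free := fun _ _ h => mul_eq_right.mp h }
      pt := (1 : A.carrier) }
  map f :=
    { toHom :=
        { onG := Hom.toMonoidHom f
          onX := Hom.toMonoidHom f
          map_m := Hom.map_m f
          map_smul := fun g x => map_mul (Hom.toMonoidHom f) g x }
      map_pt := map_one (Hom.toMonoidHom f) }

end MedianGroup

/-! The geometric content is that every free action embeds into a free and transitive one;
everything else is universal algebra on top of it.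

For the embedding, copies of the median set are glued into a tree in which each point lies in
exactly one copy for each orbit. Paths are determined by their projections on the copies
(`eq_of_proj_eq`), so the tree sits in a power of the median set, and it is closed under
coordinatewise medians (`exists_isMed`). Seen from a copy through the root, the median structure
does not depend on which copy was chosen (`isMed_glue_iff`), so changes of chart are automorphisms.
Together with the given group acting on the base copy they generate an action of the free product of
that group with the free group on the non-base orbits. An equivariant map from the tree to this
group acting by translations (`treeElt_treeAct`) gives freeness; `exists_smul_root` gives
transitivity.

The relatively-transitive closure consists of formal expressions modulo the identities that hold
under all relatively transitive morphisms. Its universal property is then formal, and the canonical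
morphism is injective because the tree is one of the targets. The free median group of a pointed
action is obtained in the same way. A free and transitive action with a base point is the same as a
median group, through the orbit map of the base point. Choosing a base point thus turns the free
median group into the reflection onto transitive actions (`existsUnique_unit_forget`), and the tree
again shows that the unit is an embedding.

One closure only puts the image of the original set in a single orbit, so it is iterated. In the
vertex of any cocone over the iterates, the union of the images is transitive: two points come from
a common stage, and the next stage puts them in one orbit. Mapping the universal transitive action
into such unions shows that it is the direct limit (`IsTransClosure.nonempty_isColimit`). -/

namespace MedianSet

variable {X : Type u} [MedianSet X]

theorem m_left (x y : X) : m x x y = x := by rw [symm_right, absorb]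

theorem m_mid (x y : X) : m x y x = x := absorb x y

theorem m_right (x y : X) : m y x x = x := by rw [symm_left, absorb]

end MedianSet

/-! ### The tree of spaces

`orb : X → O` is a surjection with section `rep`. A tree of copies of `X` is obtained by gluing to
each point of type `orb x` one copy of `X`, at its point `rep b`, for each `b ≠ orb x`. Its points
are encoded by the reduced lists of pairs `(b, x)`: enter a copy at its point `rep b`, move to its
point `x`. -/

namespace TreeOfSpaces

open MedianSet Classical

variable {X O : Type u}

/-- The first step of the list does not enter a copy at `rep b`. -/
def Avoids (b : O) : List (O × X) → Prop
  | [] => True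
  | p :: _ => p.1 ≠ b

/-- The reduced lists: no step is trivial, and no step stays in the copy of the previous one. -/
def Reduced (orb : X → O) (rep : O → X) : List (O × X) → Prop
  | [] => True
  | p :: t => p.2 ≠ rep p.1 ∧ Avoids (orb p.2) t ∧ Reduced orb rep t

/-- The projection on the copy attached at the root through `rep b`. -/
noncomputable def head (rep : O → X) (b : O) : List (O × X) → X
  | [] => rep b
  | p :: _ => if p.1 = b then p.2 else rep b

/-- The projection on the branches at the point `q` of the copy attached at the root through
`rep b`. -/
noncomputable def tail (b : O) (q : X) : List (O × X) → List (O × X)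
  | [] => []
  | p :: t => if p = (b, q) then t else []

/-- The projection on an arbitrary copy. -/
noncomputable def proj (rep : O → X) : List (O × X) → O → List (O × X) → X
  | [], b, l => head rep b l
  | p :: c, b, l => proj rep c b (tail p.1 p.2 l)

theorem exists_cons_of_not_avoids {b : O} {l : List (O × X)} (h : ¬ Avoids b l) :
    ∃ x t, l = (b, x) :: t := by
  match l, h with
  | [], h => exact absurd trivial h
  | (b', x) :: t, h => exact ⟨x, t, by simp only [Avoids, not_not] at h; rw [h]⟩

variable {orb : X → O} {rep : O → X}

theorem head_of_avoids {b : O} {l : List (O × X)} (h : Avoids b l) : head rep b l = rep b := by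
  match l, h with
  | [], _ => rfl
  | p :: t, h => exact if_neg h

theorem tail_of_avoids {b : O} (q : X) {l : List (O × X)} (h : Avoids b l) :
    tail b q l = [] := by
  match l, h with
  | [], _ => rfl
  | p :: t, h => exact if_neg fun e => h (by rw [e])

theorem head_of_tail_ne_nil {b : O} {q : X} {l : List (O × X)} (h : tail b q l ≠ []) :
    head rep b l = q := by
  match l, h with
  | [], h => exact absurd rfl h
  | p :: t, h =>
    by_cases e : p = (b, q)
    · subst e; exact if_pos rfl
    · exact absurd (if_neg e) h

theorem avoids_of_not_avoids {b b' : O} (hb : b' ≠ b) {l : List (O × X)} (h : ¬ Avoids b l) :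
    Avoids b' l := by
  obtain ⟨x, t, rfl⟩ := exists_cons_of_not_avoids h
  exact hb.symm

theorem avoids_tail {l : List (O × X)} (h : Reduced orb rep l) (b : O) (q : X) :
    Avoids (orb q) (tail b q l) := by
  match l, h with
  | [], _ => trivial
  | p :: t, h =>
    by_cases e : p = (b, q)
    · subst e; simpa [tail] using h.2.1
    · rw [tail, if_neg e]; trivial

theorem reduced_tail {l : List (O × X)} (h : Reduced orb rep l) (b : O) (q : X) :
    Reduced orb rep (tail b q l) := by
  match l, h with
  | [], _ => trivial
  | p :: t, h =>
    by_cases e : p = (b, q)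
    · subst e; simpa [tail] using h.2.2
    · rw [tail, if_neg e]; trivial

theorem tail_rep {l : List (O × X)} (h : Reduced orb rep l) (b : O) :
    tail b (rep b) l = [] := by
  match l, h with
  | [], _ => rfl
  | p :: t, h => exact if_neg fun e => h.1 (by rw [e])

theorem length_tail_le (b : O) (q : X) (l : List (O × X)) :
    (tail b q l).length ≤ l.length := by
  match l with
  | [] => exact le_rfl
  | p :: t =>
    by_cases e : p = (b, q) <;> simp [tail, e]

theorem length_tail_lt {b : O} (q : X) {l : List (O × X)} (h : ¬ Avoids b l) :
    (tail b q l).length < l.length := by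
  obtain ⟨x, t, rfl⟩ := exists_cons_of_not_avoids h
  by_cases e : x = q <;> simp [tail, e]

/-- The first step of a reduced path is visible in the heads: it is the only place where a head
differs from `rep b`, since steps are nontrivial. Once the first steps agree, they can be stripped
off. -/
theorem eq_of_proj_eq {l l' : List (O × X)} (h : Reduced orb rep l) (h' : Reduced orb rep l')
    (e : ∀ c b, proj rep c b l = proj rep c b l') : l = l' := by
  induction l generalizing l' with
  | nil =>
    match l', h' with
    | [], _ => rfl
    | p :: t, h' =>
      have := e [] p.1
      simp only [proj, head, if_true] at this
      exact absurd this.symm h'.1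
  | cons p t ih =>
    have e1 := e [] p.1
    match l', h' with
    | [], h' =>
      simp only [proj, head, if_true] at e1
      exact absurd e1 h.1
    | p' :: t', h' =>
      by_cases hp : p'.1 = p.1
      · simp only [proj, head, if_true, if_pos hp] at e1
        have hpp : p' = p := Prod.ext hp e1.symm
        subst hpp
        refine congrArg _ (ih h.2.2 h'.2.2 fun c b => ?_)
        simpa [proj, tail] using e (p' :: c) b
      · simp only [proj, head, if_true, if_neg hp] at e1
        exact absurd e1 h.1

/-! ### Points of the tree and their charts from a copy at the root -/

variable (orb rep) in
/-- The points of the tree of spaces. -/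
structure Point : Type u where
  path : List (O × X)
  reduced : Reduced orb rep path

@[ext]
theorem Point.ext_proj {w w' : Point orb rep}
    (h : ∀ c b, proj rep c b w.path = proj rep c b w'.path) : w = w' := by
  obtain ⟨l, hl⟩ := w
  obtain ⟨l', hl'⟩ := w'
  obtain rfl : l = l' := eq_of_proj_eq hl hl' h
  rfl

variable (orb rep) in
/-- The points of the tree of spaces, seen from a copy at the root: the projection on this copy, and
the path from there. -/
structure Chart : Type u where
  pos : X
  path : List (O × X)
  avoids : Avoids (orb pos) path
  reduced : Reduced orb rep path

/-- The point of the tree of spaces with given position with respect to the copy attached at the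
root through `rep b`. -/
noncomputable def glue (b : O) (d : Chart orb rep) : Point orb rep :=
  if h : d.pos = rep b then ⟨d.path, d.reduced⟩ else ⟨(b, d.pos) :: d.path, h, d.avoids, d.reduced⟩

theorem glue_of_eq {b : O} {d : Chart orb rep} (h : d.pos = rep b) :
    glue b d = ⟨d.path, d.reduced⟩ := dif_pos h

theorem glue_of_ne {b : O} {d : Chart orb rep} (h : d.pos ≠ rep b) :
    glue b d = ⟨(b, d.pos) :: d.path, h, d.avoids, d.reduced⟩ := dif_neg h

theorem Chart.avoids_of_eq (hr : ∀ b, orb (rep b) = b) {b : O} {d : Chart orb rep}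
    (h : d.pos = rep b) : Avoids b d.path := by
  have := d.avoids
  rwa [h, hr] at this

/-- The position of a point with respect to the copy attached at the root through `rep b`. -/
noncomputable def chart (hr : ∀ b, orb (rep b) = b) (b : O) : Point orb rep → Chart orb rep
  | ⟨[], _⟩ => ⟨rep b, [], trivial, trivial⟩
  | ⟨p :: t, h⟩ => if e : p.1 = b then ⟨p.2, t, h.2.1, h.2.2⟩ else
      ⟨rep b, p :: t, by rw [hr]; exact e, h⟩

theorem chart_glue (hr : ∀ b, orb (rep b) = b) (b : O) (d : Chart orb rep) :
    chart hr b (glue b d) = d := by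
  by_cases e : d.pos = rep b
  · rw [glue_of_eq e]
    obtain ⟨x, t, h, h'⟩ := d
    match t, h, h' with
    | [], h, h' => cases e; rfl
    | p :: t, h, h' =>
      cases e
      exact dif_neg (by rw [hr] at h; exact h)
  · rw [glue_of_ne e]
    exact dif_pos rfl

theorem glue_chart (hr : ∀ b, orb (rep b) = b) (b : O) (w : Point orb rep) :
    glue b (chart hr b w) = w := by
  obtain ⟨l, h⟩ := w
  match l, h with
  | [], h => exact dif_pos rfl
  | p :: t, h =>
    by_cases e : p.1 = b
    · have : chart hr b ⟨p :: t, h⟩ = ⟨p.2, t, h.2.1, h.2.2⟩ := dif_pos e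
      subst e
      rw [this]
      exact dif_neg h.1
    · have : chart hr b ⟨p :: t, h⟩ = ⟨rep b, p :: t, by rw [hr]; exact e, h⟩ := dif_neg e
      rw [this]
      exact dif_pos rfl

/-- The positions with respect to a copy at the root describe the points of the tree of spaces. -/
noncomputable def glueEquiv (hr : ∀ b, orb (rep b) = b) (b : O) :
    Chart orb rep ≃ Point orb rep :=
  ⟨glue b, chart hr b, chart_glue hr b, glue_chart hr b⟩

/-- The path, if it starts at the point `y` of the copy. -/
noncomputable def Chart.branch (d : Chart orb rep) (y : X) : List (O × X) :=
  if d.pos = y then d.path else []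

theorem Chart.avoids_branch (hr : ∀ b, orb (rep b) = b) (b : O) (d : Chart orb rep) :
    Avoids b (d.branch (rep b)) := by
  by_cases e : d.pos = rep b
  · rw [Chart.branch, if_pos e]
    exact d.avoids_of_eq hr e
  · rw [Chart.branch, if_neg e]; trivial

theorem head_glue (hr : ∀ b, orb (rep b) = b) (b : O) (d : Chart orb rep) :
    head rep b (glue b d).path = d.pos := by
  by_cases e : d.pos = rep b
  · rw [glue_of_eq e, e]
    exact head_of_avoids (d.avoids_of_eq hr e)
  · rw [glue_of_ne e]; exact if_pos rfl

theorem tail_glue {b : O} {q : X} (hq : q ≠ rep b) (hr : ∀ b, orb (rep b) = b)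
    (d : Chart orb rep) : tail b q (glue b d).path = d.branch q := by
  by_cases e : d.pos = rep b
  · rw [glue_of_eq e, Chart.branch, e, if_neg hq.symm]
    exact tail_of_avoids _ (d.avoids_of_eq hr e)
  · rw [glue_of_ne e]
    by_cases e : d.pos = q <;> simp [tail, Chart.branch, e]

theorem head_glue_of_ne {b b' : O} (hb : b' ≠ b) (d : Chart orb rep) :
    head rep b' (glue b d).path = head rep b' (d.branch (rep b)) := by
  by_cases e : d.pos = rep b
  · rw [glue_of_eq e, Chart.branch, if_pos e]
  · rw [glue_of_ne e, Chart.branch, if_neg e]; exact if_neg hb.symm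

theorem tail_glue_of_ne {b b' : O} (hb : b' ≠ b) (q : X) (d : Chart orb rep) :
    tail b' q (glue b d).path = tail b' q (d.branch (rep b)) := by
  by_cases e : d.pos = rep b
  · rw [glue_of_eq e, Chart.branch, if_pos e]
  · rw [glue_of_ne e, Chart.branch, if_neg e]; exact tail_of_avoids _ hb.symm

/-! ### Medians in the tree of spaces -/

variable [MedianSet X]

/-- The last list is the median of the first three in all projections. -/
def IsMed (rep : O → X) (l₁ l₂ l₃ l : List (O × X)) : Prop :=
  ∀ c b, proj rep c b l = m (proj rep c b l₁) (proj rep c b l₂) (proj rep c b l₃)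

theorem isMed_iff {l₁ l₂ l₃ l : List (O × X)} : IsMed rep l₁ l₂ l₃ l ↔
    (∀ b, head rep b l = m (head rep b l₁) (head rep b l₂) (head rep b l₃)) ∧
    ∀ b q, IsMed rep (tail b q l₁) (tail b q l₂) (tail b q l₃) (tail b q l) :=
  ⟨fun h => ⟨fun b => h [] b, fun b q c b' => h ((b, q) :: c) b'⟩, fun h c b => by
    match c with
    | [] => exact h.1 b
    | p :: c => exact h.2 p.1 p.2 c b⟩

/-- Two of three elements satisfy `p`. -/
def TwoOf {α : Type*} (p : α → Prop) (a b c : α) : Prop := (p a ∧ p b) ∨ (p a ∧ p c) ∨ (p b ∧ p c)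

theorem TwoOf.m_eq {α : Type*} {p : α → Prop} {a b c : α} (h : TwoOf p a b c) {f : α → X} {x : X}
    (hp : ∀ a, p a → f a = x) : m (f a) (f b) (f c) = x := by
  rcases h with ⟨h, h'⟩ | ⟨h, h'⟩ | ⟨h, h'⟩ <;> rw [hp _ h, hp _ h']
  exacts [m_left _ _, m_mid _ _, m_right _ _]

theorem twoOf_or_twoOf_not {α : Type*} (p : α → Prop) (a b c : α) :
    TwoOf p a b c ∨ TwoOf (fun a => ¬ p a) a b c := by
  unfold TwoOf; tauto

theorem TwoOf.isMed {l₁ l₂ l₃ l : List (O × X)} {p : List (O × X) → Prop} (h : TwoOf p l₁ l₂ l₃)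
    {f : List (O × X) → List (O × X)} (hp : ∀ a, p a → f a = l) :
    IsMed rep (f l₁) (f l₂) (f l₃) l := fun c b =>
  (h.m_eq (f := fun a => proj rep c b (f a)) fun a ha => by rw [hp a ha]).symm

/-- If two tails are empty, they outvote the third. If two are nonempty, the corresponding heads are
both `q`, and so is their median. -/
theorem isMed_tail_nil {l₁ l₂ l₃ : List (O × X)} {b : O} {q : X}
    (h : m (head rep b l₁) (head rep b l₂) (head rep b l₃) ≠ q) :
    IsMed rep (tail b q l₁) (tail b q l₂) (tail b q l₃) [] := by
  rcases twoOf_or_twoOf_not (fun l => tail b q l = []) l₁ l₂ l₃ with h' | h'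
  · exact h'.isMed fun _ h => h
  · exact absurd (h'.m_eq fun _ h => head_of_tail_ne_nil h) h

/-- If the medians of the heads are trivial in all copies at the root, the median is the root.
Otherwise two of the paths enter the same copy `b`; the median enters it too, at the median `q` of
the heads, and continues with the median of the tails at `q`. The clause on `Avoids` is carried
through the induction to keep the extended path reduced. -/
theorem exists_isMed {l₁ l₂ l₃ : List (O × X)} (h₁ : Reduced orb rep l₁)
    (h₂ : Reduced orb rep l₂) (h₃ : Reduced orb rep l₃) :
    ∃ l, Reduced orb rep l ∧ IsMed rep l₁ l₂ l₃ l ∧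
      ∀ b, Avoids b l₁ → Avoids b l₂ → Avoids b l₃ → Avoids b l := by
  induction hn : l₁.length + l₂.length + l₃.length using Nat.strong_induction_on
    generalizing l₁ l₂ l₃ with
  | _ n ih =>
    by_cases hb : ∃ b, m (head rep b l₁) (head rep b l₂) (head rep b l₃) ≠ rep b
    · obtain ⟨b, hb⟩ := hb
      -- If two of the paths avoided `b`, their heads, and hence the median, would be `rep b`.
      have two : TwoOf (fun l => ¬ Avoids b l) l₁ l₂ l₃ :=
        (twoOf_or_twoOf_not _ _ _ _).resolve_left fun h =>
          hb (h.m_eq fun _ h => head_of_avoids h)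
      set q := m (head rep b l₁) (head rep b l₂) (head rep b l₃) with hq
      -- A path that enters `b` loses at least its first step.
      have hlt : (tail b q l₁).length + (tail b q l₂).length + (tail b q l₃).length < n := by
        have i₁ := length_tail_le b q l₁
        have i₂ := length_tail_le b q l₂
        have i₃ := length_tail_le b q l₃
        rcases two with h | h | h
        · have := length_tail_lt q h.1; omega
        · have := length_tail_lt q h.1; omega
        · have := length_tail_lt q h.1; omega
      obtain ⟨t, ht, hm, ha⟩ := ih _ hlt (reduced_tail h₁ b q) (reduced_tail h₂ b q)
        (reduced_tail h₃ b q) rfl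
      refine ⟨(b, q) :: t, ⟨hb, ha _ (avoids_tail h₁ b q) (avoids_tail h₂ b q)
        (avoids_tail h₃ b q), ht⟩, isMed_iff.2 ⟨fun b' => ?_, fun b' q' => ?_⟩, ?_⟩
      · by_cases e : b' = b
        · subst e; simp [head, hq]
        · rw [two.m_eq (f := head rep b') fun _ h => head_of_avoids (avoids_of_not_avoids e h)]
          exact if_neg (Ne.symm e)
      · by_cases e : b' = b
        · subst e
          by_cases e : q' = q
          · subst e; simpa [tail] using hm
          · have : tail b' q' ((b', q) :: t) = [] := if_neg (by simp [Ne.symm e])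
            rw [this]
            exact isMed_tail_nil (Ne.symm e)
        · have : tail b' q' ((b, q) :: t) = [] := tail_of_avoids _ (Ne.symm e)
          rw [this]
          exact two.isMed fun _ h => tail_of_avoids _ (avoids_of_not_avoids e h)
      · rintro b' a₁ a₂ a₃ rfl
        rcases two with h | h | h
        exacts [h.1 a₁, h.1 a₁, h.1 a₂]
    · push Not at hb
      refine ⟨[], trivial, isMed_iff.2 ⟨fun b => (hb b).symm, fun b q => ?_⟩,
        fun _ _ _ _ => trivial⟩
      by_cases e : q = rep b
      · subst e
        rw [tail_rep h₁, tail_rep h₂, tail_rep h₃]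
        exact fun _ _ => (m_left _ _).symm
      · exact isMed_tail_nil (by rw [hb]; exact Ne.symm e)

/-- The median of three points of the tree of spaces. -/
noncomputable def Point.med (w₁ w₂ w₃ : Point orb rep) : Point orb rep :=
  ⟨_, (exists_isMed w₁.reduced w₂.reduced w₃.reduced).choose_spec.1⟩

theorem Point.proj_med (w₁ w₂ w₃ : Point orb rep) :
    IsMed rep w₁.path w₂.path w₃.path (w₁.med w₂ w₃).path :=
  (exists_isMed w₁.reduced w₂.reduced w₃.reduced).choose_spec.2.1

noncomputable instance : MedianSet (Point orb rep) where
  m := Point.med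
  symm_left x y z := by
    ext c b; rw [Point.proj_med, Point.proj_med, MedianSet.symm_left]
  symm_right x y z := by
    ext c b; rw [Point.proj_med, Point.proj_med, MedianSet.symm_right]
  absorb x y := by
    ext c b; rw [Point.proj_med, MedianSet.absorb]
  selfdistrib x y z v w := by
    ext c b; simp only [Point.proj_med _ _ _ _ _]; exact MedianSet.selfdistrib _ _ _ _ _

theorem Point.eq_m_iff {w₁ w₂ w₃ w : Point orb rep} :
    w = m w₁ w₂ w₃ ↔ IsMed rep w₁.path w₂.path w₃.path w.path := by
  refine ⟨?_, fun h => ?_⟩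
  · rintro rfl; exact Point.proj_med _ _ _
  · ext c b; rw [h]; exact (Point.proj_med _ _ _ _ _).symm

/-- The median relation on the positions with respect to a copy. -/
def Chart.IsMed (d₁ d₂ d₃ d : Chart orb rep) : Prop :=
  d.pos = m d₁.pos d₂.pos d₃.pos ∧
    ∀ y, TreeOfSpaces.IsMed rep (d₁.branch y) (d₂.branch y) (d₃.branch y) (d.branch y)

theorem isMed_self {l : List (O × X)} : IsMed rep l l l l := fun _ _ => (m_left _ _).symm

/-- The right-hand side does not mention `b`; this is what makes changes of chart automorphisms. The
branch at a point `y ≠ rep b` is a tail in the copy `b`, while the branch at `rep b` is what the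
other copies through the root see. -/
theorem isMed_glue_iff (hr : ∀ b, orb (rep b) = b) (b : O) {d₁ d₂ d₃ d : Chart orb rep} :
    IsMed rep (glue b d₁).path (glue b d₂).path (glue b d₃).path (glue b d).path ↔
      Chart.IsMed d₁ d₂ d₃ d := by
  constructor
  · intro h
    obtain ⟨hh, ht⟩ := isMed_iff.1 h
    refine ⟨by simpa only [head_glue hr] using hh b, fun y => ?_⟩
    by_cases e : y = rep b
    · subst e
      refine isMed_iff.2 ⟨fun b' => ?_, fun b' q => ?_⟩
      · by_cases e : b' = b
        · subst e
          simp only [head_of_avoids (Chart.avoids_branch hr _ _), m_left]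
        · simpa only [head_glue_of_ne e] using hh b'
      · by_cases e : b' = b
        · subst e
          simp only [tail_of_avoids _ (Chart.avoids_branch hr _ _), isMed_self]
        · simpa only [tail_glue_of_ne e] using ht b' q
    · simpa only [tail_glue e hr] using ht b y
  · rintro ⟨h, hy⟩
    refine isMed_iff.2 ⟨fun b' => ?_, fun b' q => ?_⟩
    · by_cases e : b' = b
      · subst e; simpa only [head_glue hr] using h
      · simpa only [head_glue_of_ne e] using (isMed_iff.1 (hy (rep b))).1 b'
    · by_cases e : b' = b
      · subst e
        by_cases e : q = rep b'
        · subst e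
          simp only [tail_rep (glue b' _).reduced, isMed_self]
        · simpa only [tail_glue e hr] using hy q
      · simpa only [tail_glue_of_ne e] using (isMed_iff.1 (hy (rep b))).2 b' q

end TreeOfSpaces

/-! ### A free and transitive action on the tree of copies -/

namespace FAMS

open MedianSet TreeOfSpaces Classical

variable (A : FAMS.{u})

/-- The set of orbits. -/
abbrev Orbit : Type u := MulAction.orbitRel.Quotient A.G A.X

variable {A}

abbrev orb (x : A.X) : A.Orbit := Quotient.mk'' x

noncomputable abbrev rep (o : A.Orbit) : A.X := Quotient.out o

theorem orb_rep (o : A.Orbit) : orb (rep o) = o := Quotient.out_eq o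

theorem orb_smul (g : A.G) (x : A.X) : orb (g • x) = orb x :=
  Quotient.sound ⟨g, rfl⟩

theorem exists_smul_rep (x : A.X) : ∃ g : A.G, g • rep (orb x) = x :=
  Quotient.exact (orb_rep (orb x)).symm

theorem eq_of_smul_eq {g h : A.G} {x : A.X} (e : g • x = h • x) : g = h := by
  have := A.free (h⁻¹ * g) x (by rw [mul_smul, e, inv_smul_smul])
  exact (inv_mul_eq_one.1 this).symm

/-- The group element taking the representative of the orbit of `x` to `x`. -/
noncomputable def coord (x : A.X) : A.G := (exists_smul_rep x).choose

theorem coord_smul (x : A.X) : coord x • rep (orb x) = x := (exists_smul_rep x).choose_spec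

theorem coord_smul_eq (g : A.G) (x : A.X) : coord (g • x) = g * coord x := by
  refine eq_of_smul_eq (x := rep (orb x)) ?_
  rw [mul_smul, coord_smul]
  conv_rhs => rw [← coord_smul (g • x), orb_smul]

theorem coord_rep (o : A.Orbit) : coord (rep o) = 1 := by
  refine A.free _ (rep o) ?_
  conv_rhs => rw [← coord_smul (rep o), orb_rep]

variable (A) in
/-- A base orbit. -/
noncomputable def baseOrbit : A.Orbit := orb A.nonempty.some

variable (A) in
/-- The points of the tree of copies of the median set of `A`. -/
abbrev Tree : Type u := Point (orb (A := A)) rep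

variable (A) in
/-- The points of the tree of copies, seen from a copy. -/
abbrev TreeChart : Type u := Chart (orb (A := A)) rep

/-- Only the position moves: what may be attached at a point depends on its orbit alone, so the path
is carried along unchanged. -/
noncomputable instance : MulAction A.G A.TreeChart where
  smul g d := ⟨g • d.pos, d.path, by rw [orb_smul]; exact d.avoids, d.reduced⟩
  one_smul d := by
    obtain ⟨x, t, h, h'⟩ := d
    change Chart.mk _ _ _ _ = _
    congr 1
    exact one_smul _ _
  mul_smul g g' d := by
    obtain ⟨x, t, h, h'⟩ := d
    change Chart.mk _ _ _ _ = Chart.mk _ _ _ _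
    congr 1
    exact mul_smul _ _ _

theorem branch_smul (g : A.G) (d : A.TreeChart) (y : A.X) :
    (g • d).branch y = d.branch (g⁻¹ • y) := by
  have : g • d.pos = y ↔ d.pos = g⁻¹ • y := by rw [eq_inv_smul_iff]
  by_cases h : d.pos = g⁻¹ • y
  · exact (if_pos (this.2 h)).trans (if_pos h).symm
  · exact (if_neg (mt this.1 h)).trans (if_neg h).symm

theorem _root_.TreeOfSpaces.Chart.IsMed.smul (g : A.G) {d₁ d₂ d₃ d : A.TreeChart}
    (h : Chart.IsMed d₁ d₂ d₃ d) : Chart.IsMed (g • d₁) (g • d₂) (g • d₃) (g • d) := by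
  refine ⟨?_, fun y => ?_⟩
  · change g • d.pos = m (g • d₁.pos) (g • d₂.pos) (g • d₃.pos)
    rw [h.1, A.smul_m]
  · simp only [branch_smul]
    exact h.2 _

/-- The position of a point with respect to a copy at the root. -/
noncomputable def treeChart (o : A.Orbit) : A.TreeChart ≃ A.Tree := glueEquiv orb_rep o

theorem treeChart_eq_m_iff (o : A.Orbit) {d₁ d₂ d₃ d : A.TreeChart} :
    treeChart o d = m (treeChart o d₁) (treeChart o d₂) (treeChart o d₃) ↔
      Chart.IsMed d₁ d₂ d₃ d :=
  Point.eq_m_iff.trans (isMed_glue_iff orb_rep o)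

/-- The group of automorphisms of a median set. -/
def _root_.MedianSet.aut (Y : Type u) [MedianSet Y] : Subgroup (Equiv.Perm Y) where
  carrier := {σ | ∀ x y z, σ (m x y z) = m (σ x) (σ y) (σ z)}
  one_mem' _ _ _ := rfl
  mul_mem' {σ τ} h h' x y z := by
    simp only [Equiv.Perm.mul_apply]
    rw [h', h]
  inv_mem' {σ} h x y z := by
    rw [Equiv.Perm.inv_eq_iff_eq, h]
    simp only [← Equiv.Perm.mul_apply, mul_inv_cancel, Equiv.Perm.one_apply]

/-- Covers both kinds of generators: the group acting on the base copy (`o = o'`) and the changes of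
chart (`g = 1`). -/
theorem treeChart_conj_mem_aut (o o' : A.Orbit) (g : A.G) :
    ((treeChart o').symm.trans (MulAction.toPerm g)).trans (treeChart o) ∈
      MedianSet.aut A.Tree := by
  intro x y z
  have h : Chart.IsMed ((treeChart o').symm x) ((treeChart o').symm y) ((treeChart o').symm z)
      ((treeChart o').symm (m x y z)) := by
    rw [← treeChart_eq_m_iff o']
    simp only [Equiv.apply_symm_apply]
  exact (treeChart_eq_m_iff o).2 (h.smul g)

variable (A) in
/-- The free product of the group of `A` and the free group on the orbits other than the base
one. -/
abbrev TreeGroup : Type u := Monoid.Coprod A.G (FreeGroup {o : A.Orbit // o ≠ A.baseOrbit})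

/-- The generator attached to an orbit, trivial for the base orbit. -/
noncomputable def gen (o : A.Orbit) : A.TreeGroup :=
  if h : o = A.baseOrbit then 1 else Monoid.Coprod.inr (FreeGroup.of ⟨o, h⟩)

-- The generator of an orbit `o` carries the copy through the root at `rep o` to the base copy,
-- keeping positions.
variable (A) in
noncomputable def treeAct : A.TreeGroup →* Equiv.Perm A.Tree :=
  Monoid.Coprod.lift
    ((treeChart A.baseOrbit).permCongrHom.toMonoidHom.comp (MulAction.toPermHom A.G A.TreeChart))
    (FreeGroup.lift fun o => (treeChart o.1).symm.trans (treeChart A.baseOrbit))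

theorem treeAct_inl (g : A.G) (d : A.TreeChart) :
    A.treeAct (Monoid.Coprod.inl g) (treeChart A.baseOrbit d) =
      treeChart A.baseOrbit (g • d) := by
  simp [treeAct]

theorem treeAct_gen (o : A.Orbit) (d : A.TreeChart) :
    A.treeAct (gen o) (treeChart o d) = treeChart A.baseOrbit d := by
  unfold gen
  split_ifs with h
  · rw [map_one, h]; rfl
  · simp [treeAct]

theorem treeAct_mem_aut (h : A.TreeGroup) : A.treeAct h ∈ MedianSet.aut A.Tree := by
  induction h using Monoid.Coprod.induction_on with
  | inl g =>
    have := treeChart_conj_mem_aut A.baseOrbit A.baseOrbit g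
    convert this using 1
    ext1 w
    obtain ⟨d, rfl⟩ := (treeChart A.baseOrbit).surjective w
    rw [treeAct_inl]
    simp
  | inr f =>
    induction f using FreeGroup.induction_on with
    | C1 => rw [map_one, map_one]; exact one_mem _
    | of o =>
      have := treeChart_conj_mem_aut A.baseOrbit o.1 1
      convert this using 1
      ext1 w
      simp [treeAct]
    | inv_of o h => rw [map_inv, map_inv]; exact inv_mem h
    | mul x y h h' => rw [map_mul, map_mul]; exact mul_mem h h'
  | mul x y h h' => rw [map_mul]; exact mul_mem h h'

/-- The group element attached to a point of `A`. -/
noncomputable def ptGen (x : A.X) : A.TreeGroup := Monoid.Coprod.inl (coord x) * gen (orb x)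

theorem ptGen_smul (g : A.G) (x : A.X) : ptGen (g • x) = Monoid.Coprod.inl g * ptGen x := by
  rw [ptGen, coord_smul_eq, orb_smul, map_mul, mul_assoc]; rfl

theorem ptGen_rep (o : A.Orbit) : ptGen (rep o) = gen o := by
  rw [ptGen, coord_rep, orb_rep, map_one, one_mul]

/-- The group element attached to a point of the tree. -/
noncomputable def treeElt (w : A.Tree) : A.TreeGroup :=
  (w.path.map fun p => (gen p.1)⁻¹ * ptGen p.2).prod

/-- The group element attached to a position with respect to a copy. -/
noncomputable def chartElt (d : A.TreeChart) : A.TreeGroup :=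
  ptGen d.pos * (d.path.map fun p => (gen p.1)⁻¹ * ptGen p.2).prod

/-- At `rep o` no step is recorded in the path, which is consistent because the factor of such a
trivial step would be `1`. -/
theorem treeElt_treeChart (o : A.Orbit) (d : A.TreeChart) :
    treeElt (treeChart o d) = (gen o)⁻¹ * chartElt d := by
  change treeElt (glue o d) = _
  by_cases h : d.pos = rep o
  · rw [glue_of_eq h, chartElt, h, ptGen_rep, inv_mul_cancel_left]; rfl
  · rw [glue_of_ne h, chartElt, ← mul_assoc]
    exact List.prod_cons

/-- Equivariance towards the group acting on itself by translations, hence freeness of the action.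
For a generator it is read off in the chart where that generator acts simply. -/
theorem treeElt_treeAct (h : A.TreeGroup) (w : A.Tree) :
    treeElt (A.treeAct h w) = h * treeElt w := by
  induction h using Monoid.Coprod.induction_on generalizing w with
  | inl g =>
    obtain ⟨d, rfl⟩ := (treeChart A.baseOrbit).surjective w
    rw [treeAct_inl, treeElt_treeChart, treeElt_treeChart]
    have : chartElt (g • d) = Monoid.Coprod.inl g * chartElt d := by
      rw [chartElt, chartElt, ← mul_assoc, ← ptGen_smul]; rfl
    simp [this, gen]
  | inr f =>
    induction f using FreeGroup.induction_on generalizing w with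
    | C1 => simp
    | of o =>
      have e : Monoid.Coprod.inr (FreeGroup.of o) = gen (A := A) o.1 := by
        rw [gen, dif_neg o.2]
      obtain ⟨d, rfl⟩ := (treeChart o.1).surjective w
      rw [e, treeAct_gen, treeElt_treeChart, treeElt_treeChart]
      simp [gen]
    | inv_of o h =>
      have := h (A.treeAct (Monoid.Coprod.inr (FreeGroup.of o))⁻¹ w)
      rw [← Equiv.Perm.mul_apply, ← map_mul, mul_inv_cancel, map_one, Equiv.Perm.one_apply] at this
      rw [map_inv, this, inv_mul_cancel_left]
    | mul x y h h' =>
      simp only [map_mul, Equiv.Perm.mul_apply, h, h', mul_assoc]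
  | mul x y h h' =>
    simp only [map_mul, Equiv.Perm.mul_apply, h, h', mul_assoc]

noncomputable instance : MulAction A.TreeGroup A.Tree := MulAction.compHom _ A.treeAct

theorem treeGroup_smul (h : A.TreeGroup) (w : A.Tree) : h • w = A.treeAct h w := rfl

/-- A first step is prepended by one group element: pass to the base copy from the chart at the
orbit of the new point, move the representative to that point, and pass to the chart of the copy
being entered. -/
theorem exists_smul_root (w : A.Tree) : ∃ h : A.TreeGroup, h • (⟨[], trivial⟩ : A.Tree) = w := by
  obtain ⟨l, hl⟩ := w
  induction l with
  | nil => exact ⟨1, one_smul _ _⟩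
  | cons p t ih =>
    obtain ⟨h, e⟩ := ih hl.2.2
    let d : A.TreeChart := ⟨p.2, t, hl.2.1, hl.2.2⟩
    let d' : A.TreeChart := ⟨rep (orb p.2), t, by rw [orb_rep]; exact hl.2.1, hl.2.2⟩
    have h₁ : treeChart p.1 d = ⟨p :: t, hl⟩ := glue_of_ne hl.1
    have h₂ : treeChart (orb p.2) d' = ⟨t, hl.2.2⟩ := glue_of_eq rfl
    have h₃ : coord p.2 • d' = d := by
      change Chart.mk _ _ _ _ = Chart.mk _ _ _ _
      congr 1
      exact coord_smul _
    refine ⟨(gen p.1)⁻¹ * Monoid.Coprod.inl (coord p.2) * gen (orb p.2) * h, ?_⟩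
    rw [mul_smul, e, ← h₁, ← h₂, mul_smul, mul_smul, inv_smul_eq_iff, treeGroup_smul,
      treeGroup_smul, treeGroup_smul, treeAct_gen, treeAct_gen, treeAct_inl, h₃]

variable (A) in
/-- The action on the tree of copies of the median set of `A`. -/
noncomputable def tree : FAMS.{u} where
  G := A.TreeGroup
  X := A.Tree
  nonempty := ⟨⟨[], trivial⟩⟩
  smul_m h := treeAct_mem_aut h
  free h w e := by
    have := treeElt_treeAct h w
    rw [← treeGroup_smul, e] at this
    exact right_eq_mul.1 this

variable (A) in
theorem isTransitive_tree : IsTransitive A.tree := fun x y => by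
  obtain ⟨h, e⟩ := exists_smul_root (A := A) x
  obtain ⟨h', e'⟩ := exists_smul_root (A := A) y
  refine ⟨(h' * h⁻¹ : A.TreeGroup), ?_⟩
  have : y = (h' * h⁻¹ : A.TreeGroup) • (show A.Tree from x) := by
    rw [mul_smul, ← e, inv_smul_smul, e']
  exact this

variable (A) in
/-- The inclusion of `A` in the tree of copies as the base copy. -/
noncomputable def toTree : A ⟶ A.tree where
  onG := Monoid.Coprod.inl
  onX x := treeChart A.baseOrbit ⟨x, [], trivial, trivial⟩
  map_m x y z := by
    refine (treeChart_eq_m_iff A.baseOrbit).2 ⟨rfl, fun w => ?_⟩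
    have (x : A.X) : (⟨x, [], trivial, trivial⟩ : A.TreeChart).branch w = [] := by
      unfold Chart.branch; split_ifs <;> rfl
    rw [this, this, this, this]
    exact isMed_self
  map_smul g x := (treeAct_inl g ⟨x, [], trivial, trivial⟩).symm

/-- By freeness a group element is determined by its effect on one point. -/
theorem Hom.isEmbedding_of_injective {A B : FAMS.{u}} (f : A ⟶ B)
    (h : Function.Injective (Hom.onX f)) : IsEmbedding f := by
  refine ⟨fun g g' e => ?_, h⟩
  obtain ⟨x⟩ := A.nonempty
  refine eq_of_smul_eq (x := x) (h ?_)
  rw [Hom.map_smul, Hom.map_smul, e]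

variable (A) in
theorem isEmbedding_toTree : IsEmbedding A.toTree :=
  Hom.isEmbedding_of_injective _ fun x y h => by
    have : (⟨x, [], trivial, trivial⟩ : A.TreeChart) = ⟨y, [], trivial, trivial⟩ :=
      (treeChart A.baseOrbit).injective h
    exact congrArg Chart.pos this

/-- Every free action embeds into a free and transitive one. -/
theorem exists_isEmbedding_isTransitive (A : FAMS.{u}) :
    ∃ (B : FAMS.{u}) (f : A ⟶ B), IsTransitive B ∧ IsEmbedding f :=
  ⟨_, A.toTree, A.isTransitive_tree, A.isEmbedding_toTree⟩

end FAMS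

/-! ### The relatively-transitive closure -/

namespace FAMS

/-- Formal medians of elements of a type. -/
inductive MedTerm (S : Type u) : Type u
  | pt : S → MedTerm S
  | m : MedTerm S → MedTerm S → MedTerm S → MedTerm S

variable {A : FAMS.{u}}

variable (A) in
noncomputable def basePt : A.X := A.nonempty.some

theorem Hom.comp_onX {A B C : FAMS.{u}} (f : A ⟶ B) (g : B ⟶ C) (x : A.X) :
    Hom.onX (f ≫ g) x = Hom.onX g (Hom.onX f x) := rfl

theorem Hom.comp_onG {A B C : FAMS.{u}} (f : A ⟶ B) (g : B ⟶ C) (x : A.G) :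
    Hom.onG (f ≫ g) x = Hom.onG g (Hom.onG f x) := rfl

theorem IsRelativelyTransitive.comp {A B C : FAMS.{u}} {f : A ⟶ B} (h : IsRelativelyTransitive f)
    (g : B ⟶ C) : IsRelativelyTransitive (f ≫ g) := fun x y => by
  obtain ⟨k, e⟩ := h x y
  exact ⟨Hom.onG g k, by rw [Hom.comp_onX, e, Hom.map_smul]; rfl⟩

theorem IsRelativelyTransitive.precomp {A B C : FAMS.{u}} (f : A ⟶ B) {g : B ⟶ C}
    (h : IsRelativelyTransitive g) : IsRelativelyTransitive (f ≫ g) := fun _ _ => h _ _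

theorem IsTransitive.isRelativelyTransitive {C : FAMS.{u}} (h : IsTransitive C) (f : A ⟶ C) :
    IsRelativelyTransitive f := fun _ _ => h _ _

theorem Hom.ext_onX {A B : FAMS.{u}} {f g : A ⟶ B} (h : ∀ x, Hom.onX f x = Hom.onX g x) :
    f = g := by
  refine Hom.ext (MonoidHom.ext fun k => ?_) (funext h)
  obtain ⟨x⟩ := A.nonempty
  refine eq_of_smul_eq (x := Hom.onX f x) ?_
  rw [← Hom.map_smul, h, h, Hom.map_smul]

theorem IsEmbedding.of_comp {A B C : FAMS.{u}} {f : A ⟶ B} {g : B ⟶ C}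
    (h : IsEmbedding (f ≫ g)) : IsEmbedding f :=
  ⟨Function.Injective.of_comp (f := Hom.onG g) h.1, Function.Injective.of_comp (f := Hom.onX g) h.2⟩

theorem IsEmbedding.mono {A B : FAMS.{u}} {f : A ⟶ B} (h : IsEmbedding f) : Mono f :=
  ⟨fun {Z} g g' e => Hom.ext_onX fun x => h.2 (by
    rw [← Hom.comp_onX, ← Hom.comp_onX, e])⟩

section

variable {C : FAMS.{u}} {f : A ⟶ C} (hf : IsRelativelyTransitive f)

/-- The group element taking the image of the base point to the image of `x`. -/
noncomputable def ratio (x : A.X) : C.G := (hf A.basePt x).choose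

theorem ratio_smul (x : A.X) : ratio hf x • Hom.onX f A.basePt = Hom.onX f x :=
  (hf A.basePt x).choose_spec.symm

/-- The extension of a relatively transitive morphism to the free group generated by the group and
the points of `A`. -/
noncomputable def evalFree : FreeGroup (A.G ⊕ A.X) →* C.G :=
  FreeGroup.lift (Sum.elim (Hom.onG f) (ratio hf))

end

variable (A) in
/-- The relations satisfied in all relatively transitive extensions of `A`. -/
def closureRel : Subgroup (FreeGroup (A.G ⊕ A.X)) where
  carrier := {w | ∀ (C : FAMS.{u}) (f : A ⟶ C) (hf : IsRelativelyTransitive f), evalFree hf w = 1}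
  one_mem' _ _ _ := map_one _
  mul_mem' h h' C f hf := by rw [map_mul, h, h', one_mul]
  inv_mem' h C f hf := by rw [map_inv, h, inv_one]

instance : (closureRel A).Normal :=
  ⟨fun w h k C f hf => by rw [map_mul, map_mul, h, mul_one, ← map_mul, mul_inv_cancel, map_one]⟩

variable (A) in
/-- The group of the relatively-transitive closure. -/
abbrev ClosureGroup : Type u := FreeGroup (A.G ⊕ A.X) ⧸ closureRel A

section

variable {C : FAMS.{u}} {f : A ⟶ C} (hf : IsRelativelyTransitive f)

noncomputable def evalGroup : A.ClosureGroup →* C.G :=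
  QuotientGroup.lift _ (evalFree hf) fun _ h => h C f hf

theorem evalGroup_inl (g : A.G) :
    evalGroup hf (FreeGroup.of (Sum.inl g) : FreeGroup (A.G ⊕ A.X)) = Hom.onG f g :=
  FreeGroup.lift_apply_of

theorem evalGroup_inr (x : A.X) :
    evalGroup hf (FreeGroup.of (Sum.inr x) : FreeGroup (A.G ⊕ A.X)) = ratio hf x :=
  FreeGroup.lift_apply_of

noncomputable def termEval : MedTerm A.ClosureGroup → C.X
  | .pt h => evalGroup hf h • Hom.onX f A.basePt
  | .m s t v => MedianSet.m (termEval s) (termEval t) (termEval v)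

end

theorem closureGroup_ext {h h' : A.ClosureGroup}
    (e : ∀ (C : FAMS.{u}) (f : A ⟶ C) (hf : IsRelativelyTransitive f),
      evalGroup hf h = evalGroup hf h') : h = h' := by
  rw [← inv_mul_eq_one]
  obtain ⟨w, hw⟩ := QuotientGroup.mk_surjective (h⁻¹ * h')
  rw [← hw, QuotientGroup.eq_one_iff]
  intro C f hf
  have : evalGroup hf (w : A.ClosureGroup) = 1 := by
    rw [hw, map_mul, map_inv, e, inv_mul_cancel]
  exact this

-- The relation quantifies over all targets but is a proposition, so the quotient stays in the same
-- universe. It plays the role of the subobject generated by `A` in the product of all relatively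
-- transitive targets.
variable (A) in
def closureSetoid : Setoid (MedTerm A.ClosureGroup) where
  r s t := ∀ (C : FAMS.{u}) (f : A ⟶ C) (hf : IsRelativelyTransitive f),
    termEval hf s = termEval hf t
  iseqv := ⟨fun _ _ _ _ => rfl, fun h C f hf => (h C f hf).symm,
    fun h h' C f hf => (h C f hf).trans (h' C f hf)⟩

variable (A) in
/-- The median set of the relatively-transitive closure. -/
def ClosureSet : Type u := Quotient (closureSetoid A)

def closureMk (t : MedTerm A.ClosureGroup) : A.ClosureSet := Quotient.mk _ t

noncomputable def evalSet {C : FAMS.{u}} {f : A ⟶ C} (hf : IsRelativelyTransitive f) : A.ClosureSet → C.X :=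
  Quotient.lift (termEval hf) fun _ _ h => h C f hf

theorem evalSet_mk {C : FAMS.{u}} {f : A ⟶ C} (hf : IsRelativelyTransitive f)
    (t : MedTerm A.ClosureGroup) : evalSet hf (closureMk t) = termEval hf t := rfl

/-- Evaluations separate points, so every identity that holds in all targets passes to the closure;
the axioms below are all checked this way. -/
theorem closureSet_ext {y y' : A.ClosureSet}
    (e : ∀ (C : FAMS.{u}) (f : A ⟶ C) (hf : IsRelativelyTransitive f),
      evalSet hf y = evalSet hf y') : y = y' := by
  induction y using Quotient.inductionOn
  induction y' using Quotient.inductionOn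
  exact Quotient.sound e

theorem closureMk_surjective : Function.Surjective (closureMk (A := A)) := Quotient.exists_rep

/-- Left translation of formal medians. -/
def MedTerm.translate {S : Type u} [Mul S] (h : S) : MedTerm S → MedTerm S
  | .pt k => .pt (h * k)
  | .m s t v => .m (s.translate h) (t.translate h) (v.translate h)

theorem termEval_translate {C : FAMS.{u}} {f : A ⟶ C} (hf : IsRelativelyTransitive f)
    (h : A.ClosureGroup) (t : MedTerm A.ClosureGroup) :
    termEval hf (t.translate h) = evalGroup hf h • termEval hf t := by
  induction t with
  | pt k => simp only [MedTerm.translate, termEval, map_mul, mul_smul]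
  | m s t v hs ht hv => simp only [MedTerm.translate, termEval, hs, ht, hv, C.smul_m]

/-- Chosen representatives replace a proof of well-definedness: evaluations do not see the choice.
-/
noncomputable instance : SMul A.ClosureGroup A.ClosureSet :=
  ⟨fun h y => closureMk (y.out.translate h)⟩

theorem evalSet_out {C : FAMS.{u}} {f : A ⟶ C} (hf : IsRelativelyTransitive f)
    (y : A.ClosureSet) : termEval hf y.out = evalSet hf y := by
  conv_rhs => rw [← Quotient.out_eq y]
  rfl

theorem evalSet_smul {C : FAMS.{u}} {f : A ⟶ C} (hf : IsRelativelyTransitive f)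
    (h : A.ClosureGroup) (y : A.ClosureSet) :
    evalSet hf (h • y) = evalGroup hf h • evalSet hf y := by
  rw [← evalSet_out hf y]
  exact termEval_translate hf h _

noncomputable instance : MulAction A.ClosureGroup A.ClosureSet where
  one_smul y := closureSet_ext fun C f hf => by rw [evalSet_smul, map_one, one_smul]
  mul_smul h h' y := closureSet_ext fun C f hf => by
    simp only [evalSet_smul, map_mul, mul_smul]

noncomputable def closureMed (x y z : A.ClosureSet) : A.ClosureSet :=
  closureMk (.m x.out y.out z.out)

theorem evalSet_med {C : FAMS.{u}} {f : A ⟶ C} (hf : IsRelativelyTransitive f)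
    (x y z : A.ClosureSet) : evalSet hf (closureMed x y z) =
      MedianSet.m (evalSet hf x) (evalSet hf y) (evalSet hf z) := by
  rw [closureMed, evalSet_mk, termEval, evalSet_out, evalSet_out, evalSet_out]

noncomputable instance : MedianSet A.ClosureSet where
  m := closureMed
  symm_left x y z := closureSet_ext fun C f hf => by
    rw [evalSet_med, evalSet_med, MedianSet.symm_left]
  symm_right x y z := closureSet_ext fun C f hf => by
    rw [evalSet_med, evalSet_med, MedianSet.symm_right]
  absorb x y := closureSet_ext fun C f hf => by rw [evalSet_med, MedianSet.absorb]
  selfdistrib x y z v w := closureSet_ext fun C f hf => by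
    simp only [evalSet_med]; exact MedianSet.selfdistrib _ _ _ _ _

theorem evalSet_m {C : FAMS.{u}} {f : A ⟶ C} (hf : IsRelativelyTransitive f)
    (x y z : A.ClosureSet) : evalSet hf (MedianSet.m x y z) =
      MedianSet.m (evalSet hf x) (evalSet hf y) (evalSet hf z) := evalSet_med hf x y z

variable (A) in
/-- The relatively-transitive closure of `A`. -/
noncomputable def closure : FAMS.{u} where
  G := A.ClosureGroup
  X := A.ClosureSet
  nonempty := ⟨closureMk (.pt 1)⟩
  smul_m h x y z := closureSet_ext fun C f hf => by
    simp only [evalSet_smul, evalSet_m, C.smul_m]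
  free h y e := closureGroup_ext fun C f hf => by
    rw [map_one]
    refine C.free _ (evalSet hf y) ?_
    rw [← evalSet_smul, e]

/-- The inclusion of the group of `A` in the group of the closure. -/
def closureInl : A.G →* A.ClosureGroup :=
  MonoidHom.mk' (fun g => (FreeGroup.of (Sum.inl g) : FreeGroup (A.G ⊕ A.X))) fun g h =>
    closureGroup_ext fun C f hf => by
      rw [map_mul, evalGroup_inl, evalGroup_inl, evalGroup_inl, map_mul]

/-- The group element of the closure attached to a point of `A`. -/
def closureElt (x : A.X) : A.ClosureGroup := (FreeGroup.of (Sum.inr x) : FreeGroup (A.G ⊕ A.X))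

theorem evalSet_pt {C : FAMS.{u}} {f : A ⟶ C} (hf : IsRelativelyTransitive f) (x : A.X) :
    evalSet hf (closureMk (.pt (closureElt x))) = Hom.onX f x :=
  (congrArg (· • _) (evalGroup_inr hf x)).trans (ratio_smul hf x)

variable (A) in
/-- The canonical morphism to the relatively-transitive closure. -/
noncomputable def toClosure : A ⟶ A.closure where
  onG := closureInl
  onX x := closureMk (.pt (closureElt x))
  map_m x y z := closureSet_ext fun C f hf => by
    refine (evalSet_pt hf _).trans (Eq.trans ?_ (evalSet_m hf _ _ _).symm)
    rw [evalSet_pt, evalSet_pt, evalSet_pt, Hom.map_m]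
  map_smul g x := closureSet_ext fun C f hf => by
    refine (evalSet_pt hf _).trans (Eq.trans ?_ (evalSet_smul hf _ _).symm)
    rw [evalSet_pt, Hom.map_smul]
    exact congrArg (· • _) (evalGroup_inl hf g).symm

theorem closureElt_smul (x y : A.X) :
    Hom.onX A.toClosure y = (closureElt y * (closureElt x)⁻¹ : A.ClosureGroup) •
      (show A.ClosureSet from Hom.onX A.toClosure x) :=
  closureSet_ext fun C f hf => by
    rw [evalSet_smul]
    refine (evalSet_pt hf _).trans (Eq.trans ?_ (congrArg _ (evalSet_pt hf _)).symm)
    rw [← ratio_smul hf x, map_mul, map_inv]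
    unfold closureElt
    rw [evalGroup_inr, evalGroup_inr, mul_smul, inv_smul_smul, ratio_smul]

/-- The extension of a relatively transitive morphism to the closure. -/
noncomputable def closureLift {C : FAMS.{u}} {f : A ⟶ C} (hf : IsRelativelyTransitive f) :
    A.closure ⟶ C where
  onG := evalGroup hf
  onX := evalSet hf
  map_m := evalSet_m hf
  map_smul := evalSet_smul hf

theorem toClosure_closureLift {C : FAMS.{u}} {f : A ⟶ C} (hf : IsRelativelyTransitive f) :
    A.toClosure ≫ closureLift hf = f := Hom.ext_onX fun x => evalSet_pt hf x

/-- On the group, the value at the generator of a point `x` is forced by freeness, since it must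
take the image of the base point to that of `x`. On the set, every element is a formal median of
translates of the base point. -/
theorem eq_closureLift {C : FAMS.{u}} {f : A ⟶ C} (hf : IsRelativelyTransitive f)
    (g : A.closure ⟶ C) (e : A.toClosure ≫ g = f) : g = closureLift hf := by
  have hX (x : A.X) : Hom.onX g (Hom.onX A.toClosure x) = Hom.onX f x := by
    rw [← e]; rfl
  have hG : Hom.onG g = evalGroup hf := by
    refine QuotientGroup.monoidHom_ext _ (FreeGroup.ext_hom _ _ ?_)
    rintro (k | x)
    · refine Eq.trans ?_ (evalGroup_inl hf k).symm
      rw [← e]; rfl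
    · refine Eq.trans ?_ (evalGroup_inr hf x).symm
      refine eq_of_smul_eq (x := Hom.onX f A.basePt) ?_
      rw [ratio_smul, ← hX x, ← hX A.basePt]
      refine (Hom.map_smul g (closureElt x : A.ClosureGroup) _).symm.trans (congrArg _ ?_)
      refine closureSet_ext fun D k hk => ?_
      refine (evalSet_smul hk _ _).trans (Eq.trans ?_ (evalSet_pt hk _).symm)
      rw [← ratio_smul hk x]
      exact congr (congrArg _ (evalGroup_inr hk x)) (evalSet_pt hk _)
  refine Hom.ext_onX fun y => ?_
  obtain ⟨t, rfl⟩ := closureMk_surjective y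
  change _ = termEval hf t
  induction t with
  | pt h =>
    rw [termEval, ← hG, ← hX]
    have : closureMk (.pt h) = h • closureMk (.pt (closureElt A.basePt)) :=
      closureSet_ext fun D k hk => by rw [evalSet_smul, evalSet_pt, evalSet_mk, termEval]
    exact (congrArg (Hom.onX g) this).trans (Hom.map_smul g _ _)
  | m s t v hs ht hv =>
    rw [termEval, ← hs, ← ht, ← hv]
    have : closureMk (.m s t v) = MedianSet.m (closureMk s) (closureMk t) (closureMk v) :=
      closureSet_ext fun D k hk => by simp only [evalSet_m, evalSet_mk, termEval]
    exact (congrArg (Hom.onX g) this).trans (Hom.map_m g _ _ _)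

variable (A) in
theorem isRelTransClosure_toClosure : IsRelTransClosure A.toClosure where
  embedding := by
    -- The embedding into the tree is relatively transitive, hence factors through the closure.
    have := A.isEmbedding_toTree
    rw [← toClosure_closureLift (A.isTransitive_tree.isRelativelyTransitive A.toTree)] at this
    exact this.of_comp
  relativelyTransitive x y := ⟨_, closureElt_smul x y⟩
  universal C f hf := ⟨closureLift hf, toClosure_closureLift hf, fun g e => eq_closureLift hf g e⟩

theorem IsRelTransClosure.hom_ext {A B C : FAMS.{u}} {i : A ⟶ B} (h : IsRelTransClosure i)
    {g g' : B ⟶ C} (e : i ≫ g = i ≫ g') : g = g' :=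
  (h.universal C (i ≫ g) (h.relativelyTransitive.comp g)).unique rfl e.symm

/-- The relatively-transitive closure as a functor. -/
noncomputable def closureFunctor : FAMS.{u} ⥤ FAMS.{u} where
  obj A := A.closure
  map {_ B} f := closureLift (IsRelativelyTransitive.precomp f
    (isRelTransClosure_toClosure B).relativelyTransitive)
  map_id A := (isRelTransClosure_toClosure A).hom_ext (by
    rw [toClosure_closureLift]; rfl)
  map_comp f g := (isRelTransClosure_toClosure _).hom_ext (by
    rw [toClosure_closureLift, ← Category.assoc, toClosure_closureLift, Category.assoc,
      Category.assoc, toClosure_closureLift])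

/-- The inclusion in the relatively-transitive closure as a natural transformation. -/
noncomputable def toClosureFunctor : 𝟭 FAMS.{u} ⟶ closureFunctor where
  app A := A.toClosure
  naturality _ _ _ := (toClosure_closureLift _).symm

theorem isRelTransClosureFunctor_toClosureFunctor :
    IsRelTransClosureFunctor toClosureFunctor.{u} := isRelTransClosure_toClosure

end FAMS

/-! ### Adjunctions and universal arrows -/

namespace CategoryTheory.Adjunction

variable {C D : Type*} [Category C] [Category D]

/-- A functor with universal arrows has a left adjoint. -/
theorem exists_of_universal_arrows (G : D ⥤ C)
    (h : ∀ X : C, ∃ (Y : D) (i : X ⟶ G.obj Y), ∀ (Z : D) (f : X ⟶ G.obj Z),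
      ∃! g : Y ⟶ Z, i ≫ G.map g = f) : ∃ L : C ⥤ D, Nonempty (L ⊣ G) := by
  choose Y i hi using h
  let e (X : C) (Z : D) : (Y X ⟶ Z) ≃ (X ⟶ G.obj Z) :=
    { toFun g := i X ≫ G.map g
      invFun f := (hi X Z f).choose
      left_inv g := ((hi X Z (i X ≫ G.map g)).choose_spec.2 g rfl).symm
      right_inv f := (hi X Z f).choose_spec.1 }
  exact ⟨_, ⟨adjunctionOfEquivLeft e fun X Z Z' g h => by
    simp only [e, Equiv.coe_fn_mk, Functor.map_comp, Category.assoc]⟩⟩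

theorem existsUnique_unit_comp {L : C ⥤ D} {G : D ⥤ C} (adj : L ⊣ G) {X : C} {Z : D}
    (f : X ⟶ G.obj Z) : ∃! g : L.obj X ⟶ Z, adj.unit.app X ≫ G.map g = f :=
  ⟨(adj.homEquiv X Z).symm f, by simp [← adj.homEquiv_unit], fun g hg => by
    rw [Equiv.eq_symm_apply, adj.homEquiv_unit]; exact hg⟩

end CategoryTheory.Adjunction

namespace FAPMS

theorem Hom.ext_onX {P Q : FAPMS.{u}} {f g : P ⟶ Q}
    (h : ∀ x, FAMS.Hom.onX (Hom.toHom f) x = FAMS.Hom.onX (Hom.toHom g) x) : f = g :=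
  Hom.ext (FAMS.Hom.ext_onX h)

end FAPMS

theorem FAMS.IsTransitive.of_iso {A B : FAMS.{u}} (e : A ≅ B) (h : FAMS.IsTransitive A) :
    FAMS.IsTransitive B := fun x y => by
  have he (z : B.X) : FAMS.Hom.onX e.hom (FAMS.Hom.onX e.inv z) = z := by
    rw [← FAMS.Hom.comp_onX, e.inv_hom_id]; rfl
  obtain ⟨g, hg⟩ := h (FAMS.Hom.onX e.inv x) (FAMS.Hom.onX e.inv y)
  refine ⟨FAMS.Hom.onG e.hom g, ?_⟩
  rw [← he y, hg, FAMS.Hom.map_smul, he]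

/-! ### Median groups as pointed free and transitive actions -/

namespace MedianGroup

open MedianSet

theorem isTransitive_toFAPMS (M : MedianGroup.{u}) :
    FAMS.IsTransitive (toFAPMS.obj M).toFAMS := fun x y =>
  ⟨(show M.carrier from y) * (show M.carrier from x)⁻¹, (inv_mul_cancel_right (G := M.carrier) y x).symm⟩

instance : toFAPMS.{u}.Faithful where
  map_injective h := Hom.ext (congrArg (fun k => FAMS.Hom.onG (FAPMS.Hom.toHom k)) h)

/-- Equivariance applied to `x = x * 1`, with the base point `1` preserved. This is why the functor
is full. -/
theorem onX_eq_onG {A B : MedianGroup.{u}} (f : toFAPMS.obj A ⟶ toFAPMS.obj B) (x : A.carrier) :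
    FAMS.Hom.onX (FAPMS.Hom.toHom f) x = FAMS.Hom.onG (FAPMS.Hom.toHom f) x := by
  have h := FAMS.Hom.map_smul (FAPMS.Hom.toHom f) x (1 : A.carrier)
  have h₁ : FAMS.Hom.onX (FAPMS.Hom.toHom f) (1 : A.carrier) = (1 : B.carrier) :=
    FAPMS.Hom.map_pt f
  rw [h₁] at h
  refine (congrArg _ (mul_one x).symm).trans (h.trans ?_)
  exact mul_one (M := B.carrier) _

instance : toFAPMS.{u}.Full where
  map_surjective {_ B} f :=
    ⟨{ toMonoidHom := FAMS.Hom.onG (FAPMS.Hom.toHom f)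
       map_m x y z :=
        have e := onX_eq_onG f
        (e (m x y z)).symm.trans ((FAMS.Hom.map_m (FAPMS.Hom.toHom f) x y z).trans
          (congr (congr (congrArg (m (X := B.carrier)) (e x)) (e y)) (e z))) }, FAPMS.Hom.ext_onX fun x => (onX_eq_onG f x).symm⟩

section ofTransitive

variable {P : FAPMS.{u}} (h : FAMS.IsTransitive P.toFAMS)

/-- The median operation on the group of a pointed free and transitive action. -/
noncomputable def groupMed (a b c : P.toFAMS.G) : P.toFAMS.G :=
  (h P.pt (m (a • P.pt) (b • P.pt) (c • P.pt))).choose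

theorem groupMed_smul (a b c : P.toFAMS.G) :
    groupMed h a b c • P.pt = m (a • P.pt) (b • P.pt) (c • P.pt) :=
  (h P.pt (m (a • P.pt) (b • P.pt) (c • P.pt))).choose_spec.symm

/-- The median group of a pointed free and transitive action. -/
@[reducible] noncomputable def ofTransitive : MedianGroup.{u} where
  carrier := P.toFAMS.G
  median :=
    { m := groupMed h
      symm_left x y z := FAMS.eq_of_smul_eq (x := P.pt) (by
        rw [groupMed_smul, groupMed_smul, symm_left])
      symm_right x y z := FAMS.eq_of_smul_eq (x := P.pt) (by
        rw [groupMed_smul, groupMed_smul, symm_right])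
      absorb x y := FAMS.eq_of_smul_eq (x := P.pt) (by rw [groupMed_smul, absorb])
      selfdistrib x y z v w := FAMS.eq_of_smul_eq (x := P.pt) (by
        simp only [groupMed_smul]; exact selfdistrib _ _ _ _ _) }
  mul_m a x y z := FAMS.eq_of_smul_eq (x := P.pt) (by
    change (a * groupMed h x y z) • P.pt = groupMed h (a * x) (a * y) (a * z) • P.pt
    simp only [mul_smul, groupMed_smul, P.toFAMS.smul_m])

/-- A pointed free and transitive action is isomorphic to the one of its median group. -/
noncomputable def ofTransitiveIso : toFAPMS.obj (ofTransitive h) ≅ P where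
  hom :=
    { toHom :=
        { onG := MonoidHom.id P.toFAMS.G
          onX := fun g : P.toFAMS.G => g • P.pt
          map_m := groupMed_smul h
          map_smul := fun a b : P.toFAMS.G => mul_smul a b P.pt }
      map_pt := one_smul P.toFAMS.G P.pt }
  inv :=
    { toHom :=
        { onG := MonoidHom.id P.toFAMS.G
          onX := fun x => (h P.pt x).choose
          map_m := fun x y z => FAMS.eq_of_smul_eq (x := P.pt) (by
            refine Eq.trans ?_ (groupMed_smul h _ _ _).symm
            rw [← (h P.pt _).choose_spec, ← (h P.pt _).choose_spec, ← (h P.pt _).choose_spec,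
              ← (h P.pt _).choose_spec])
          map_smul := fun g x => FAMS.eq_of_smul_eq (x := P.pt) (by
            refine Eq.trans ?_ (mul_smul g _ P.pt).symm
            rw [← (h P.pt _).choose_spec, ← (h P.pt _).choose_spec]) }
      map_pt := FAMS.eq_of_smul_eq (x := P.pt) (by
        refine Eq.trans ?_ (one_smul P.toFAMS.G P.pt).symm
        rw [← (h P.pt _).choose_spec]) }
  hom_inv_id := FAPMS.Hom.ext_onX fun g => FAMS.eq_of_smul_eq (x := P.pt)
    (h P.pt _).choose_spec.symm
  inv_hom_id := FAPMS.Hom.ext_onX fun x => (h P.pt x).choose_spec.symm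

end ofTransitive

theorem essImage_toFAPMS_iff (P : FAPMS.{u}) :
    toFAPMS.{u}.essImage P ↔ FAMS.IsTransitive P.toFAMS :=
  ⟨fun ⟨M, ⟨e⟩⟩ => M.isTransitive_toFAPMS.of_iso (FAPMS.forget.mapIso e),
    fun h => ⟨_, ⟨ofTransitiveIso h⟩⟩⟩

theorem essImage_toFAPMS_forget_iff (A : FAMS.{u}) :
    (toFAPMS.{u} ⋙ FAPMS.forget.{u}).essImage A ↔ FAMS.IsTransitive A :=
  ⟨fun ⟨M, ⟨e⟩⟩ => M.isTransitive_toFAPMS.of_iso e,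
    fun h => ⟨_, ⟨FAPMS.forget.mapIso
      (ofTransitiveIso (P := ⟨A, A.nonempty.some⟩) h)⟩⟩⟩

/-- The formal expressions in the elements of a group and of a set in the language of median
groups. -/
inductive Term (G X : Type u) : Type u
  | ofG : G → Term G X
  | ofX : X → Term G X
  | mul : Term G X → Term G X → Term G X
  | inv : Term G X → Term G X
  | m : Term G X → Term G X → Term G X → Term G X

/-! ### The median group freely generated by a pointed free action -/

section free

variable {P : FAPMS.{u}}

def termEval {M : MedianGroup.{u}} (f : P ⟶ toFAPMS.obj M) :
    Term P.toFAMS.G P.toFAMS.X → M.carrier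
  | .ofG g => FAMS.Hom.onG (FAPMS.Hom.toHom f) g
  | .ofX x => FAMS.Hom.onX (FAPMS.Hom.toHom f) x
  | .mul s t => termEval f s * termEval f t
  | .inv s => (termEval f s)⁻¹
  | .m s t v => MedianSet.m (termEval f s) (termEval f t) (termEval f v)

variable (P) in
def freeSetoid : Setoid (Term P.toFAMS.G P.toFAMS.X) where
  r s t := ∀ (M : MedianGroup.{u}) (f : P ⟶ toFAPMS.obj M), termEval f s = termEval f t
  iseqv := ⟨fun _ _ _ => rfl, fun h M f => (h M f).symm,
    fun h h' M f => (h M f).trans (h' M f)⟩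

variable (P) in
/-- The underlying set of the median group freely generated by a pointed free action. -/
def Free : Type u := Quotient (freeSetoid P)

def freeMk (t : Term P.toFAMS.G P.toFAMS.X) : Free P := Quotient.mk _ t

def freeEval {M : MedianGroup.{u}} (f : P ⟶ toFAPMS.obj M) : Free P → M.carrier :=
  Quotient.lift (termEval f) fun _ _ h => h M f

theorem free_ext {a b : Free P}
    (h : ∀ (M : MedianGroup.{u}) (f : P ⟶ toFAPMS.obj M), freeEval f a = freeEval f b) :
    a = b := by
  induction a using Quotient.inductionOn
  induction b using Quotient.inductionOn
  exact Quotient.sound h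

theorem termEval_out {M : MedianGroup.{u}} (f : P ⟶ toFAPMS.obj M) (a : Free P) :
    termEval f a.out = freeEval f a := by
  conv_rhs => rw [← Quotient.out_eq a]
  rfl

noncomputable instance : Mul (Free P) := ⟨fun a b => freeMk (.mul a.out b.out)⟩

instance : One (Free P) := ⟨freeMk (.ofG 1)⟩

noncomputable instance : Inv (Free P) := ⟨fun a => freeMk (.inv a.out)⟩

noncomputable def freeMed (a b c : Free P) : Free P := freeMk (.m a.out b.out c.out)

section

variable {M : MedianGroup.{u}} (f : P ⟶ toFAPMS.obj M)

theorem freeEval_mul (a b : Free P) : freeEval f (a * b) = freeEval f a * freeEval f b := by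
  rw [← termEval_out f a, ← termEval_out f b]; rfl

theorem freeEval_one : freeEval f (1 : Free P) = 1 := map_one _

theorem freeEval_inv (a : Free P) : freeEval f a⁻¹ = (freeEval f a)⁻¹ := by
  rw [← termEval_out f a]; rfl

theorem freeEval_med (a b c : Free P) : freeEval f (freeMed a b c) =
    MedianSet.m (freeEval f a) (freeEval f b) (freeEval f c) := by
  rw [← termEval_out f a, ← termEval_out f b, ← termEval_out f c]; rfl

end

noncomputable instance : Group (Free P) :=
  Group.ofLeftAxioms
    (fun a b c => free_ext fun M f => by simp only [freeEval_mul, mul_assoc])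
    (fun a => free_ext fun M f => by rw [freeEval_mul, freeEval_one, one_mul])
    (fun a => free_ext fun M f => by
      rw [freeEval_mul, freeEval_inv, freeEval_one, inv_mul_cancel])

variable (P) in
/-- The median group freely generated by a pointed free action. -/
@[reducible] noncomputable def free : MedianGroup.{u} where
  carrier := Free P
  median :=
    { m := freeMed
      symm_left x y z := free_ext fun M f => by
        rw [freeEval_med, freeEval_med, symm_left]
      symm_right x y z := free_ext fun M f => by
        rw [freeEval_med, freeEval_med, symm_right]
      absorb x y := free_ext fun M f => by rw [freeEval_med, absorb]
      selfdistrib x y z v w := free_ext fun M f => by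
        simp only [freeEval_med]; exact selfdistrib _ _ _ _ _ }
  mul_m a x y z := free_ext fun M f => by
    change freeEval f (a * freeMed x y z) = freeEval f (freeMed (a * x) (a * y) (a * z))
    simp only [freeEval_med, freeEval_mul, M.mul_m]

variable (P) in
/-- The inclusion of the generators. -/
noncomputable def toFree : P ⟶ toFAPMS.obj (free P) where
  toHom :=
    { onG := MonoidHom.mk' (M := P.toFAMS.G) (G := Free P) (fun g => freeMk (.ofG g)) fun g h =>
        free_ext fun M f => by
          rw [freeEval_mul]
          exact map_mul _ _ _
      onX := fun x => freeMk (.ofX x)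
      map_m := fun x y z => free_ext fun M f =>
        (FAMS.Hom.map_m (FAPMS.Hom.toHom f) x y z).trans
          (freeEval_med f (freeMk (.ofX x)) (freeMk (.ofX y)) (freeMk (.ofX z))).symm
      map_smul := fun g x => free_ext fun M f =>
        (FAMS.Hom.map_smul (FAPMS.Hom.toHom f) g x).trans
          (freeEval_mul f (freeMk (.ofG g)) (freeMk (.ofX x))).symm }
  map_pt := free_ext fun M f => (FAPMS.Hom.map_pt f).trans (freeEval_one f).symm

/-- The extension of a morphism to the freely generated median group. -/
noncomputable def freeLift {M : MedianGroup.{u}} (f : P ⟶ toFAPMS.obj M) : free P ⟶ M where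
  toMonoidHom := MonoidHom.mk' (M := Free P) (freeEval f) (freeEval_mul f)
  map_m := freeEval_med f

theorem toFree_freeLift {M : MedianGroup.{u}} (f : P ⟶ toFAPMS.obj M) :
    toFree P ≫ toFAPMS.map (freeLift f) = f := FAPMS.Hom.ext_onX fun _ => rfl

theorem eq_freeLift {M : MedianGroup.{u}} (f : P ⟶ toFAPMS.obj M) (g : free P ⟶ M)
    (e : toFree P ≫ toFAPMS.map g = f) : g = freeLift f := by
  refine Hom.ext (MonoidHom.ext fun a => ?_)
  obtain ⟨t, rfl⟩ := Quotient.exists_rep a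
  change Hom.toMonoidHom g (freeMk t) = termEval f t
  induction t with
  | ofG k => rw [← e]; rfl
  | ofX x => rw [← e]; rfl
  | mul s t hs ht =>
    have : freeMk (.mul s t) = freeMk s * freeMk t := free_ext fun M f => by
      rw [freeEval_mul]; rfl
    rw [termEval, ← hs, ← ht, this]
    exact map_mul (Hom.toMonoidHom g) _ _
  | inv s hs =>
    have : freeMk (.inv s) = (freeMk s)⁻¹ := free_ext fun M f => by
      rw [freeEval_inv]; rfl
    rw [termEval, ← hs, this]
    exact map_inv (Hom.toMonoidHom g) _
  | m s t v hs ht hv =>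
    have : freeMk (.m s t v) = freeMed (freeMk s) (freeMk t) (freeMk v) :=
      free_ext fun M f => by rw [freeEval_med]; rfl
    rw [termEval, ← hs, ← ht, ← hv, this]
    exact Hom.map_m g _ _ _

end free

theorem exists_leftAdjoint : ∃ F : FAPMS.{u} ⥤ MedianGroup.{u}, Nonempty (F ⊣ toFAPMS.{u}) :=
  Adjunction.exists_of_universal_arrows _ fun P => ⟨free P, toFree P, fun _ f =>
    ⟨freeLift f, toFree_freeLift f, fun g e => eq_freeLift f g e⟩⟩

/-! ### Universality and injectivity of the unit -/

section

variable {F : FAPMS.{u} ⥤ MedianGroup.{u}} (adj : F ⊣ toFAPMS.{u}) (P : FAPMS.{u})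

/-- The unit is universal among the morphisms to the free and transitive actions. -/
theorem existsUnique_unit_forget {C : FAMS.{u}} (hC : FAMS.IsTransitive C) (f : P.toFAMS ⟶ C) :
    ∃! g : (toFAPMS.obj (F.obj P)).toFAMS ⟶ C,
      FAPMS.Hom.toHom (adj.unit.app P) ≫ g = f := by
  -- The target is pointed by the image of the base point, so that `f` becomes a morphism to an
  -- action isomorphic to that of a median group.
  let Q : FAPMS.{u} := ⟨C, FAMS.Hom.onX f P.pt⟩
  let f' : P ⟶ Q := ⟨f, rfl⟩
  let e : _ ≅ Q := ofTransitiveIso (P := Q) hC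
  obtain ⟨k, hk, huniq⟩ := adj.existsUnique_unit_comp (f' ≫ e.inv)
  refine ⟨FAPMS.Hom.toHom (toFAPMS.map k ≫ e.hom), ?_, fun g hg => ?_⟩
  · have : (adj.unit.app P ≫ toFAPMS.map k) ≫ e.hom = f' := by
      rw [hk, Category.assoc, e.inv_hom_id, Category.comp_id]
    exact congrArg FAPMS.Hom.toHom this
  -- Any extension `g` preserves base points automatically, because the unit does.
  · let g' : toFAPMS.obj (F.obj P) ⟶ Q :=
      ⟨g, (congrArg (FAMS.Hom.onX g) (FAPMS.Hom.map_pt (adj.unit.app P)).symm).trans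
        (congrArg (fun h => FAMS.Hom.onX h P.pt) hg)⟩
    obtain ⟨k', hk'⟩ := toFAPMS.map_surjective (g' ≫ e.inv)
    have hg' : adj.unit.app P ≫ g' = f' := FAPMS.Hom.ext hg
    have : k' = k := huniq k' (by
      change adj.unit.app P ≫ toFAPMS.map k' = _
      rw [hk', ← hg', Category.assoc])
    have h : g' = toFAPMS.map k ≫ e.hom := by
      rw [← this, hk', Category.assoc, e.inv_hom_id, Category.comp_id]
    exact congrArg FAPMS.Hom.toHom h

theorem isEmbedding_unit : FAMS.IsEmbedding (FAPMS.Hom.toHom (adj.unit.app P)) := by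
  obtain ⟨B, f, hB, hf⟩ := FAMS.exists_isEmbedding_isTransitive P.toFAMS
  obtain ⟨g, rfl, -⟩ := existsUnique_unit_forget adj P hB f
  exact hf.of_comp

theorem mono_unit : Mono (adj.unit.app P) :=
  ⟨fun _ _ h => FAPMS.Hom.ext_onX fun x => (isEmbedding_unit adj P).2
    (congrArg (fun k => FAMS.Hom.onX (FAPMS.Hom.toHom k) x) h)⟩

end

end MedianGroup

/-! ### Direct limits of relatively-transitive closures -/

namespace FAMS

/-- A subgroup acting on a median subset. -/
structure SubAction (D : FAMS.{u}) where
  group : Subgroup D.G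
  set : Set D.X
  nonempty : set.Nonempty
  m_mem : ∀ {x y z}, x ∈ set → y ∈ set → z ∈ set → MedianSet.m x y z ∈ set
  smul_mem : ∀ {g x}, g ∈ group → x ∈ set → g • x ∈ set

namespace SubAction

variable {D : FAMS.{u}} (S : SubAction D)

/-- A subaction as an action. -/
def toFAMS : FAMS.{u} where
  G := S.group
  X := S.set
  median :=
    { m := fun x y z => ⟨MedianSet.m x.1 y.1 z.1, S.m_mem x.2 y.2 z.2⟩
      symm_left := fun _ _ _ => Subtype.ext (MedianSet.symm_left _ _ _)
      symm_right := fun _ _ _ => Subtype.ext (MedianSet.symm_right _ _ _)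
      absorb := fun _ _ => Subtype.ext (MedianSet.absorb _ _)
      selfdistrib := fun _ _ _ _ _ => Subtype.ext (MedianSet.selfdistrib _ _ _ _ _) }
  action :=
    { smul := fun g x => ⟨g.1 • x.1, S.smul_mem g.2 x.2⟩
      one_smul := fun _ => Subtype.ext (one_smul _ _)
      mul_smul := fun _ _ _ => Subtype.ext (mul_smul _ _ _) }
  nonempty := S.nonempty.to_subtype
  smul_m _ _ _ _ := Subtype.ext (D.smul_m _ _ _ _)
  free g x h := Subtype.ext (D.free g.1 x.1 (congrArg Subtype.val h))

/-- The inclusion of a subaction. -/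
def incl : S.toFAMS ⟶ D where
  onG := S.group.subtype
  onX := fun x : S.set => x.1
  map_m _ _ _ := rfl
  map_smul _ _ := rfl

theorem isEmbedding_incl : IsEmbedding S.incl :=
  Hom.isEmbedding_of_injective _ fun _ _ h => Subtype.ext h

/-- The factorization of a morphism through a subaction. -/
def lift {A : FAMS.{u}} (f : A ⟶ D) (hG : ∀ g, Hom.onG f g ∈ S.group)
    (hX : ∀ x, Hom.onX f x ∈ S.set) : A ⟶ S.toFAMS where
  onG := (Hom.onG f).codRestrict S.group hG
  onX x := (⟨Hom.onX f x, hX x⟩ : S.set)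
  map_m _ _ _ := Subtype.ext (Hom.map_m f _ _ _)
  map_smul _ _ := Subtype.ext (Hom.map_smul f _ _)

end SubAction

section cocone

variable {F : ℕ ⥤ FAMS.{u}} (t : Cocone F)

theorem onX_ι_map {n k : ℕ} (h : n ≤ k) (x : (F.obj n).X) :
    Hom.onX (t.ι.app k) (Hom.onX (F.map (homOfLE h)) x) = Hom.onX (t.ι.app n) x := by
  rw [← Hom.comp_onX, t.w]

theorem onG_ι_map {n k : ℕ} (h : n ≤ k) (g : (F.obj n).G) :
    Hom.onG (t.ι.app k) (Hom.onG (F.map (homOfLE h)) g) = Hom.onG (t.ι.app n) g := by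
  rw [← Hom.comp_onG, t.w]

/-- The union of the images of a direct system in the vertex of a cocone. -/
def imageUnion : SubAction t.pt where
  group :=
    { carrier := {g | ∃ n a, Hom.onG (t.ι.app n) a = g}
      one_mem' := ⟨0, 1, map_one _⟩
      mul_mem' := by
        rintro _ _ ⟨n, a, rfl⟩ ⟨k, b, rfl⟩
        exact ⟨max n k, Hom.onG (F.map (homOfLE (le_max_left n k))) a *
          Hom.onG (F.map (homOfLE (le_max_right n k))) b, by
            rw [map_mul, onG_ι_map, onG_ι_map]⟩
      inv_mem' := by
        rintro _ ⟨n, a, rfl⟩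
        exact ⟨n, a⁻¹, map_inv _ _⟩ }
  set := {x | ∃ n a, Hom.onX (t.ι.app n) a = x}
  nonempty := ⟨_, 0, (F.obj 0).nonempty.some, rfl⟩
  m_mem := by
    rintro _ _ _ ⟨n, a, rfl⟩ ⟨k, b, rfl⟩ ⟨l, c, rfl⟩
    have hn : n ≤ max n (max k l) := le_max_left _ _
    have hk : k ≤ max n (max k l) := (le_max_left _ _).trans (le_max_right _ _)
    have hl : l ≤ max n (max k l) := (le_max_right _ _).trans (le_max_right _ _)
    exact ⟨_, MedianSet.m (Hom.onX (F.map (homOfLE hn)) a) (Hom.onX (F.map (homOfLE hk)) b)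
      (Hom.onX (F.map (homOfLE hl)) c), by
        rw [Hom.map_m, onX_ι_map, onX_ι_map, onX_ι_map]⟩
  smul_mem := by
    rintro _ _ ⟨n, a, rfl⟩ ⟨k, b, rfl⟩
    exact ⟨max n k, Hom.onG (F.map (homOfLE (le_max_left n k))) a •
      Hom.onX (F.map (homOfLE (le_max_right n k))) b, by
        rw [Hom.map_smul, onG_ι_map, onX_ι_map]⟩

/-- The corestriction of a cocone to the union of the images. -/
def toImageUnion (n : ℕ) : F.obj n ⟶ (imageUnion t).toFAMS :=
  (imageUnion t).lift (t.ι.app n) (fun a => ⟨n, a, rfl⟩) fun a => ⟨n, a, rfl⟩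

theorem toImageUnion_incl (n : ℕ) : toImageUnion t n ≫ (imageUnion t).incl = t.ι.app n := rfl

theorem imageUnion_hom_ext {C : FAMS.{u}} {v v' : (imageUnion t).toFAMS ⟶ C}
    (h : ∀ n, toImageUnion t n ≫ v = toImageUnion t n ≫ v') : v = v' :=
  Hom.ext_onX fun ⟨x, n, a, e⟩ => by
    subst e
    exact congrArg (fun k => Hom.onX k a) (h n)

/-- Two points are moved to a common stage; one stage later they lie in one orbit. -/
theorem isTransitive_imageUnion
    (hF : ∀ n, IsRelativelyTransitive (F.map (homOfLE (Nat.le_add_right n 1)))) :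
    IsTransitive (imageUnion t).toFAMS := by
  rintro ⟨_, n, a, rfl⟩ ⟨_, k, b, rfl⟩
  obtain ⟨g, hg⟩ := hF (max n k) (Hom.onX (F.map (homOfLE (le_max_left n k))) a)
    (Hom.onX (F.map (homOfLE (le_max_right n k))) b)
  refine ⟨⟨Hom.onG (t.ι.app _) g, _, g, rfl⟩, Subtype.ext ?_⟩
  have := congrArg (Hom.onX (t.ι.app _)) hg
  rw [Hom.map_smul, onX_ι_map, onX_ι_map, onX_ι_map, onX_ι_map] at this
  exact this

end cocone

/-- `i : A ⟶ B` is universal among the morphisms from `A` to free and transitive actions. -/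
structure IsTransClosure {A B : FAMS.{u}} (i : A ⟶ B) : Prop where
  transitive : IsTransitive B
  universal : ∀ (C : FAMS.{u}) (f : A ⟶ C), IsTransitive C → ∃! g : B ⟶ C, i ≫ g = f

/-- A sequence of relatively-transitive closures converges to the transitive closure. -/
theorem IsTransClosure.nonempty_isColimit {F : ℕ ⥤ FAMS.{u}}
    (hF : ∀ n, IsRelTransClosure (F.map (homOfLE (Nat.le_add_right n 1)))) {s : Cocone F}
    (hs : IsTransClosure (s.ι.app 0)) : Nonempty (IsColimit s) := by
  have hrel n := (hF n).relativelyTransitive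
  -- Agreement at stage 0 propagates, since a morphism out of a closure is determined on the
  -- previous stage.
  have key (t : Cocone F) (u : s.pt ⟶ (imageUnion t).toFAMS)
      (hu : s.ι.app 0 ≫ u = toImageUnion t 0) (n : ℕ) : s.ι.app n ≫ u = toImageUnion t n := by
    induction n with
    | zero => exact hu
    | succ n ih =>
      refine (hF n).hom_ext ?_
      rw [← Category.assoc, s.w, ih]
      refine Hom.ext_onX fun x => (imageUnion t).isEmbedding_incl.2 ?_
      exact (onX_ι_map t (Nat.le_add_right n 1) x).symm
  -- By universality the identity of `s.pt` factors through the union of the images of the stages,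
  -- so the legs are jointly epimorphic.
  have epi {C : FAMS.{u}} (v v' : s.pt ⟶ C) (h : ∀ n, s.ι.app n ≫ v = s.ι.app n ≫ v') :
      v = v' := by
    obtain ⟨u, hu, -⟩ := hs.universal _ (toImageUnion s 0) (isTransitive_imageUnion s hrel)
    have hid : u ≫ (imageUnion s).incl = 𝟙 s.pt :=
      (hs.universal _ (s.ι.app 0) hs.transitive).unique
        (by rw [← Category.assoc]; exact congrArg (· ≫ (imageUnion s).incl) hu)
        (Category.comp_id _)
    have : (imageUnion s).incl ≫ v = (imageUnion s).incl ≫ v' :=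
      imageUnion_hom_ext s fun n => h n
    rw [← Category.id_comp v, ← Category.id_comp v', ← hid, Category.assoc, this, Category.assoc]
  have ex (t : Cocone F) : ∃ v : s.pt ⟶ t.pt, ∀ n, s.ι.app n ≫ v = t.ι.app n := by
    obtain ⟨u, hu, -⟩ := hs.universal _ (toImageUnion t 0) (isTransitive_imageUnion t hrel)
    exact ⟨u ≫ (imageUnion t).incl, fun n => by
      rw [← Category.assoc, key t u hu n, toImageUnion_incl]⟩
  exact ⟨{
    desc := fun t => (ex t).choose
    fac := fun t => (ex t).choose_spec
    uniq := fun t v hv => epi _ _ fun n => (hv n).trans ((ex t).choose_spec n).symm }⟩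

/-- The functor of transitive actions `T` receives a unique extension of each morphism `s : F ⟶ T`
to the relatively-transitive closure of `F`. -/
noncomputable def extendTrans {R F T : FAMS.{u} ⥤ FAMS.{u}} {r : 𝟭 FAMS.{u} ⟶ R}
    (hr : IsRelTransClosureFunctor r) (hT : ∀ A, IsTransitive (T.obj A)) (s : F ⟶ T) :
    F ⋙ R ⟶ T where
  app A := ((hr (F.obj A)).universal _ (s.app A) ((hT A).isRelativelyTransitive _)).choose
  naturality A B f := (hr (F.obj A)).hom_ext (by
    have h (A : FAMS.{u}) : r.app (F.obj A) ≫
        ((hr (F.obj A)).universal _ (s.app A) ((hT A).isRelativelyTransitive _)).choose =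
          s.app A :=
      ((hr (F.obj A)).universal _ (s.app A) ((hT A).isRelativelyTransitive _)).choose_spec.1
    have hn := r.naturality (F.map f)
    rw [← Category.assoc, ← Category.assoc, h, ← s.naturality]
    refine (congrArg (· ≫ _) hn.symm).trans ?_
    rw [Category.assoc, h]
    rfl)

theorem extendTrans_app {R F T : FAMS.{u} ⥤ FAMS.{u}} {r : 𝟭 FAMS.{u} ⟶ R}
    (hr : IsRelTransClosureFunctor r) (hT : ∀ A, IsTransitive (T.obj A)) (s : F ⟶ T)
    (A : FAMS.{u}) : r.app (F.obj A) ≫ (extendTrans hr hT s).app A = s.app A :=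
  ((hr (F.obj A)).universal _ (s.app A) ((hT A).isRelativelyTransitive _)).choose_spec.1

/-- The extensions of a morphism `s : 𝟭 ⟶ T` to the iterated relatively-transitive closures. -/
noncomputable def extendIter {R T : FAMS.{u} ⥤ FAMS.{u}} {r : 𝟭 FAMS.{u} ⟶ R}
    (hr : IsRelTransClosureFunctor r) (hT : ∀ A, IsTransitive (T.obj A)) (s : 𝟭 FAMS.{u} ⟶ T) :
    (n : ℕ) → (iter R n ⟶ T)
  | 0 => s
  | n + 1 => extendTrans hr hT (extendIter hr hT s n)

/-- The cocone of the extensions to the iterated relatively-transitive closures. -/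
noncomputable def extendIterSystem {R T : FAMS.{u} ⥤ FAMS.{u}} {r : 𝟭 FAMS.{u} ⟶ R}
    (hr : IsRelTransClosureFunctor r) (hT : ∀ A, IsTransitive (T.obj A)) (s : 𝟭 FAMS.{u} ⟶ T) :
    iterSystem r ⟶ (Functor.const ℕ).obj T :=
  NatTrans.ofSequence (F := iterSystem r) (extendIter hr hT s) fun n => by
    refine (congrArg (· ≫ _) (Functor.ofSequence_map_homOfLE_succ (iterStep r) n)).trans ?_
    refine NatTrans.ext (funext fun A => ?_)
    exact (extendTrans_app hr hT (extendIter hr hT s n) A).trans (Category.comp_id _).symm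

theorem isRelTransClosure_iterSystem {R : FAMS.{u} ⥤ FAMS.{u}} {r : 𝟭 FAMS.{u} ⟶ R}
    (hr : IsRelTransClosureFunctor r) (A : FAMS.{u}) (n : ℕ) :
    IsRelTransClosure ((iterSystem r ⋙ (evaluation FAMS.{u} FAMS.{u}).obj A).map
      (homOfLE (Nat.le_add_right n 1))) := by
  rw [Functor.comp_map, iterSystem, Functor.ofSequence_map_homOfLE_succ]
  exact hr _

end FAMS

/-! ### The reflection onto free and transitive actions -/

namespace FTAMS

open FAMS

section

variable {TC : FAMS.{u} ⥤ FTAMS.{u}} (adj : TC ⊣ FTAMS.incl.{u}) (A : FAMS.{u})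

theorem isTransClosure_unit : IsTransClosure (adj.unit.app A) where
  transitive := (TC.obj A).property
  universal C f hC := by
    obtain ⟨g, hg, h⟩ := adj.existsUnique_unit_comp (Z := (⟨C, hC⟩ : FTAMS.{u})) f
    exact ⟨g.hom, hg, fun g' hg' => congrArg (fun k => FTAMS.incl.map k)
      (h (ObjectProperty.homMk g') hg')⟩

theorem isEmbedding_unit : IsEmbedding (adj.unit.app A) := by
  obtain ⟨B, f, hB, hf⟩ := exists_isEmbedding_isTransitive A
  obtain ⟨g, rfl, -⟩ := (isTransClosure_unit adj A).universal B f hB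
  exact hf.of_comp

end

/-- The free median group on `A` with an arbitrary base point is universal even among morphisms that
ignore base points, so no direct limit has to be constructed. -/
theorem exists_leftAdjoint : ∃ TC : FAMS.{u} ⥤ FTAMS.{u}, Nonempty (TC ⊣ FTAMS.incl.{u}) := by
  obtain ⟨F, ⟨adj⟩⟩ := MedianGroup.exists_leftAdjoint.{u}
  refine Adjunction.exists_of_universal_arrows _ fun A => ?_
  let P : FAPMS.{u} := ⟨A, A.basePt⟩
  refine ⟨⟨_, (F.obj P).isTransitive_toFAPMS⟩, FAPMS.Hom.toHom (adj.unit.app P), fun Z f => ?_⟩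
  obtain ⟨g, hg, h⟩ := MedianGroup.existsUnique_unit_forget adj P Z.property f
  exact ⟨ObjectProperty.homMk g, hg, fun g' hg' =>
    ObjectProperty.hom_ext _ (h (FTAMS.incl.map g') hg')⟩

end FTAMS

theorem FAMS.IsTransClosure.exists_iso {A B B' : FAMS.{u}} {i : A ⟶ B} {i' : A ⟶ B'}
    (h : FAMS.IsTransClosure i) (h' : FAMS.IsTransClosure i') : ∃ e : B ≅ B', i ≫ e.hom = i' := by
  obtain ⟨g, hg, -⟩ := h.universal _ i' h'.transitive
  obtain ⟨g', hg', -⟩ := h'.universal _ i h.transitive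
  exact ⟨⟨g, g',
    (h.universal _ i h.transitive).unique (by rw [← Category.assoc, hg, hg']) (Category.comp_id _),
    (h'.universal _ i' h'.transitive).unique (by rw [← Category.assoc, hg', hg])
      (Category.comp_id _)⟩, hg⟩

theorem MedianGroup.isTransClosure_unit {F : FAPMS.{u} ⥤ MedianGroup.{u}}
    (adj : F ⊣ toFAPMS.{u}) (P : FAPMS.{u}) :
    FAMS.IsTransClosure (FAPMS.forget.map (adj.unit.app P)) where
  transitive := (F.obj P).isTransitive_toFAPMS
  universal _ f hC := existsUnique_unit_forget adj P hC f

theorem theorem5p1 :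
    -- relatively-transitive closures exist, functorially
    (∃ (R : FAMS.{u} ⥤ FAMS.{u}) (r : 𝟭 FAMS.{u} ⟶ R), FAMS.IsRelTransClosureFunctor r) ∧
    -- FTAMS is a reflective full subcategory of FAMS
    Nonempty (Reflective FTAMS.incl.{u}) ∧
    (∀ (TC : FAMS.{u} ⥤ FTAMS.{u}) (adj : TC ⊣ FTAMS.incl.{u}),
      -- the reflector is the direct limit of the iterated relatively-transitive closures, both in
      -- the category of endofunctors and objectwise, the unit being its canonical map at stage 0
      (∀ (R : FAMS.{u} ⥤ FAMS.{u}) (r : 𝟭 FAMS.{u} ⟶ R), FAMS.IsRelTransClosureFunctor r →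
        ∃ s : FAMS.iterSystem r ⟶ (Functor.const ℕ).obj (TC ⋙ FTAMS.incl.{u}),
          s.app 0 = adj.unit ∧
          Nonempty (IsColimit (Cocone.mk (TC ⋙ FTAMS.incl.{u}) s)) ∧
          ∀ A : FAMS.{u}, Nonempty (IsColimit
            (((evaluation FAMS.{u} FAMS.{u}).obj A).mapCocone
              (Cocone.mk (TC ⋙ FTAMS.incl.{u}) s)))) ∧
      -- the counit is an isomorphism
      IsIso adj.counit ∧
      -- the unit is a natural monomorphism, in fact an embedding
      (∀ A : FAMS.{u}, Mono (adj.unit.app A) ∧ FAMS.IsEmbedding (adj.unit.app A))) ∧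
    -- median groups form a reflective full subcategory of FAPMS
    Nonempty (Reflective MedianGroup.toFAPMS.{u}) ∧
    -- median groups are the same as pointed free transitive actions, and every free transitive
    -- action comes from a median group
    (∀ P : FAPMS.{u},
      MedianGroup.toFAPMS.{u}.essImage P ↔ FAMS.IsTransitive P.toFAMS) ∧
    (∀ A : FAMS.{u},
      (MedianGroup.toFAPMS.{u} ⋙ FAPMS.forget.{u}).essImage A ↔ FAMS.IsTransitive A) ∧
    -- the unit embeds each pointed free action into the median group freely generated by it,
    -- and forgetting the base points this is the transitive closure
    (∀ (F : FAPMS.{u} ⥤ MedianGroup.{u}) (adj : F ⊣ MedianGroup.toFAPMS.{u}),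
      IsIso adj.counit ∧
      (∀ P : FAPMS.{u}, Mono (adj.unit.app P) ∧
        FAMS.IsEmbedding (FAPMS.forget.map (adj.unit.app P))) ∧
      ∀ (TC : FAMS.{u} ⥤ FTAMS.{u}) (adjTC : TC ⊣ FTAMS.incl.{u}) (P : FAPMS.{u}),
        ∃ e : FTAMS.incl.{u}.obj (TC.obj (FAPMS.forget.obj P)) ≅
            FAPMS.forget.obj (MedianGroup.toFAPMS.obj (F.obj P)),
          adjTC.unit.app (FAPMS.forget.obj P) ≫ e.hom =
            FAPMS.forget.map (adj.unit.app P)) := by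

  refine ⟨⟨_, _, FAMS.isRelTransClosureFunctor_toClosureFunctor⟩, ?_, fun TC adj => ⟨?_, ?_, ?_⟩,
    ?_, MedianGroup.essImage_toFAPMS_iff, MedianGroup.essImage_toFAPMS_forget_iff,
    fun F adj => ⟨?_, fun P => ⟨MedianGroup.mono_unit adj P, MedianGroup.isEmbedding_unit adj P⟩,
      fun TC adjTC P => (FTAMS.isTransClosure_unit adjTC _).exists_iso
        (MedianGroup.isTransClosure_unit adj P)⟩⟩
  · obtain ⟨TC, ⟨adj⟩⟩ := FTAMS.exists_leftAdjoint.{u}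
    exact ⟨{ L := TC, adj := adj }⟩
  · intro R r hr
    have hT (A : FAMS.{u}) : FAMS.IsTransitive ((TC ⋙ FTAMS.incl.{u}).obj A) :=
      (TC.obj A).property
    have hA (A : FAMS.{u}) : Nonempty (IsColimit
        (((evaluation FAMS.{u} FAMS.{u}).obj A).mapCocone
          (Cocone.mk (TC ⋙ FTAMS.incl.{u}) (FAMS.extendIterSystem hr hT adj.unit)))) :=
      FAMS.IsTransClosure.nonempty_isColimit (FAMS.isRelTransClosure_iterSystem hr A)
        (FTAMS.isTransClosure_unit adj A)
    -- The leg at stage 0 is the unit by construction, and the limit of endofunctors follows from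
    -- the objectwise ones.
    exact ⟨FAMS.extendIterSystem hr hT adj.unit, rfl,
      ⟨evaluationJointlyReflectsColimits _ fun A => (hA A).some⟩, hA⟩
  -- The right adjoint is fully faithful, so the counit is invertible.
  · infer_instance
  · exact fun A => ⟨(FTAMS.isEmbedding_unit adj A).mono, FTAMS.isEmbedding_unit adj A⟩
  · obtain ⟨F, ⟨adj⟩⟩ := MedianGroup.exists_leftAdjoint.{u}
    exact ⟨{ L := F, adj := adj }⟩
  · infer_instance
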